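/- Let $\mathbb F$ be a subfield of $\mathbb R$ closed under $x\mapsto\sqrt{1+x^2}$, and let $\mathbb A=\mathbb F^2$ with the usual dot product. A functional $\xi:\mathbb A\to\mathbb F$ that is affine and nonconstant is called regular. A *polygon* in $\mathbb A$ is a union of finitely many bounded sets, each of which is an intersection of finitely many closed half-planes $\{x\in\mathbb A:\xi(x)\ge 0\}$ ($\xi$ regular) and is not contained in a line (the empty union is allowed). Its *area* is the Lebesgue measure of its closure in $\mathbb R^2$. Two subsets of $\mathbb A$ are *congruent* if some distance-preserving bijection of $\mathbb A$ maps one onto the other. Let $\widetilde{\mathbb A}$ be the set of all $(x;\rho_1,\rho_2)$ with $x\in\mathbb A$ and $(\rho_1,\rho_2)$ an orthonormal pair of vectors in $\mathbb F^2$, and let $\kappa(x;\rho_1,\rho_2)=x$. For regular $\xi$, the *refined half-plane* of $\xi$ is the set of $(x;\rho_1,\rho_2)\in\widetilde{\mathbb A}$ for which the first nonzero entry of $(\xi(x),\ \xi(x+\rho_1),\ \xi(x+\rho_1+\rho_2))$ exists and is positive. A *refined (possibly unbounded) $2$-polytope* is a finite union of finite intersections of refined half-planes. For a polygon $P$ in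 $\mathbb A$, its *refinement* $\widetilde P$ is the unique refined $2$-polytope with $\kappa(\widetilde P)=P$. **Theorem (Wallace–Bolyai–Gerwien).** Two polygons $P$ and $Q$ in $\mathbb A$ have the same area if and only if $\widetilde P$ and $\widetilde Q$ are equidecomposable, i.e. there exist an integer $m\ge 0$ and nonempty polygons $P_1,\dots,P_m,Q_1,\dots,Q_m$ in $\mathbb A$ such that $$\widetilde P=\bigsqcup_{i=1}^m\widetilde P_i,\qquad \widetilde Q=\bigsqcup_{i=1}^m\widetilde Q_i$$ are partitions (disjoint unions of sets) and $P_i$ is congruent to $Q_i$ for every $i$. -/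

import Mathlib

noncomputable section

namespace RefinedGeometry

/-- The coordinate space `F ^ d` over a subfield `F` of the reals
(used both as an affine space and as a vector space). -/
abbrev Space (F : Subfield ℝ) (d : ℕ) : Type := Fin d → F

/-! ### Conventional polytopes -/

/-- An affine functional is regular if it has full rank, i.e. if it is not constant. -/
def Regular {F : Subfield ℝ} {d : ℕ} (ξ : Space F d →ᵃ[F] F) : Prop :=
  ξ.linear ≠ 0

/-- The closed half-space `{ξ ≥ 0}`. -/
def closedHalfSpace {F : Subfield ℝ} {d : ℕ} (ξ : Space F d →ᵃ[F] F) : Set (Space F d) :=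
  {x | 0 ≤ ξ x}

/-- A convex polytope: a bounded intersection of finitely many closed half-spaces. -/
def IsConvexPolytope {F : Subfield ℝ} {d : ℕ} (C : Set (Space F d)) : Prop :=
  Bornology.IsBounded C ∧
    ∃ Ξ : Finset (Space F d →ᵃ[F] F),
      (∀ ξ ∈ Ξ, Regular ξ) ∧ C = ⋂ ξ ∈ Ξ, closedHalfSpace ξ

/-- The rank of a nonempty set: the dimension of the smallest affine subspace containing it. -/
def rank {F : Subfield ℝ} {d : ℕ} (C : Set (Space F d)) : ℕ :=
  Module.finrank F (affineSpan F C).direction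

/-- A `k`-polytope: the union of finitely many (nonempty) convex polytopes of rank `k`. -/
def IsPolytope {F : Subfield ℝ} {d : ℕ} (k : ℕ) (P : Set (Space F d)) : Prop :=
  ∃ 𝒞 : Set (Set (Space F d)), 𝒞.Finite ∧
    (∀ C ∈ 𝒞, IsConvexPolytope C ∧ C.Nonempty ∧ rank C = k) ∧ P = ⋃₀ 𝒞

/-- A polygon is a `2`-polytope. -/
def IsPolygon {F : Subfield ℝ} {d : ℕ} (P : Set (Space F d)) : Prop :=
  IsPolytope 2 P

/-! ### Refined polytopes of full dimension -/

/-- The resolution of a point of `F ^ d`: the orthonormal `d`-tuples of vectors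
with respect to the dot product. -/
def Resolution (F : Subfield ℝ) (d : ℕ) : Type :=
  {ρ : Fin d → Space F d // ∀ i j, ρ i ⬝ᵥ ρ j = if i = j then 1 else 0}

/-- The refined `d`-space of `F ^ d`: pairs `(x; ρ)` of a point and an orthonormal `d`-tuple. -/
abbrev RefinedSpace (F : Subfield ℝ) (d : ℕ) : Type := Space F d × Resolution F d

/-- The closing map `(x; ρ) ↦ x`. -/
def closing {F : Subfield ℝ} {d : ℕ} (z : RefinedSpace F d) : Space F d := z.1

/-- The refinement of an affine functional `ξ`:
`(x; v₁, …, v_d) ↦ (ξ x, ξ (x + v₁), …, ξ (x + v₁ + ⋯ + v_d))`. -/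
def refineFunctional {F : Subfield ℝ} {d : ℕ} (ξ : Space F d →ᵃ[F] F)
    (x : Space F d) (v : Fin d → Space F d) : Fin (d + 1) → F :=
  fun i => ξ (x + ∑ j : Fin d with j.castSucc < i, v j)

/-- Lexicographic positivity `a ≻ 0`: the first nonzero entry exists and is positive. -/
def LexPos {F : Subfield ℝ} {n : ℕ} (a : Fin n → F) : Prop :=
  ∃ i₀, 0 < a i₀ ∧ ∀ i < i₀, a i = 0

/-- The refined half-space of points `(x; ρ)` at which the refinement of `ξ` is `≻ 0`. -/
def refinedHalfSpace {F : Subfield ℝ} {d : ℕ} (ξ : Space F d →ᵃ[F] F) :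
    Set (RefinedSpace F d) :=
  {z | LexPos (refineFunctional ξ z.1 z.2.1)}

/-- A (possibly unbounded) refined convex `d`-polytope in `F ^ d`. -/
def IsRefinedConvexPolytope {F : Subfield ℝ} {d : ℕ} (S : Set (RefinedSpace F d)) : Prop :=
  ∃ Ξ : Finset (Space F d →ᵃ[F] F),
    (∀ ξ ∈ Ξ, Regular ξ) ∧ S = ⋂ ξ ∈ Ξ, refinedHalfSpace ξ

/-- A (possibly unbounded) refined `d`-polytope in `F ^ d`. -/
def IsRefinedPolytope {F : Subfield ℝ} {d : ℕ} (S : Set (RefinedSpace F d)) : Prop :=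
  ∃ 𝒮 : Set (Set (RefinedSpace F d)), 𝒮.Finite ∧
    (∀ C ∈ 𝒮, IsRefinedConvexPolytope C) ∧ S = ⋃₀ 𝒮

/-- The refined `d`-polytope corresponding to a `d`-polytope `P` of `F ^ d`: the inverse image
of `P` under the map `S ↦ closing '' S` from refined `d`-polytopes to subsets of `F ^ d`. -/
def refinement {F : Subfield ℝ} {d : ℕ} (P : Set (Space F d)) : Set (RefinedSpace F d) :=
  Function.invFunOn (fun S : Set (RefinedSpace F d) => closing '' S) {S | IsRefinedPolytope S} P

/-! ### Area, congruence, equidecomposability -/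

/-- The area of a polygon of `F ^ 2`: the Lebesgue measure of the polygon that it spans in `ℝ ^ 2`,
which is the topological closure of its image (`F` may be countable, but it is dense in `ℝ`). -/
def area {F : Subfield ℝ} (P : Set (Space F 2)) : ENNReal :=
  MeasureTheory.volume (closure ((fun (x : Space F 2) (i : Fin 2) => (x i : ℝ)) '' P))

/-- Two figures are congruent if a bijection of `F ^ d` that preserves the Euclidean distance
carries one to the other. -/
def Congruent {F : Subfield ℝ} {d : ℕ} (P Q : Set (Space F d)) : Prop :=
  ∃ g : Space F d ≃ Space F d,
    (∀ x y, (g x - g y) ⬝ᵥ (g x - g y) = (x - y) ⬝ᵥ (x - y)) ∧ g '' P = Q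

/-- The refined polygons `refinement (P i)`, `i < m`, corresponding to the nonempty polygons `P i`, form a
partition of `S`. -/
def IsRefinedPartition {F : Subfield ℝ} {m : ℕ} (P : Fin m → Set (Space F 2))
    (S : Set (RefinedSpace F 2)) : Prop :=
  (∀ i, IsPolygon (P i) ∧ (P i).Nonempty) ∧
    (∀ i j, i ≠ j → Disjoint (refinement (P i)) (refinement (P j))) ∧
    S = ⋃ i, refinement (P i)

/-- Two sets in the refined plane are equidecomposable if they can be partitioned into the same
number of refined polygons such that corresponding polygons are congruent. -/
def Equidecomposable {F : Subfield ℝ} (S T : Set (RefinedSpace F 2)) : Prop :=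
  ∃ (m : ℕ) (P Q : Fin m → Set (Space F 2)),
    IsRefinedPartition P S ∧ IsRefinedPartition Q T ∧ ∀ i, Congruent (P i) (Q i)

end RefinedGeometry

end

/-! A point (x; ρ₁, ρ₂) of the refined plane stands for the infinitesimal region of points x + ερ₁ +
δρ₂ with 0 < δ ≪ ε ≪ 1, encoded by the filter `germ`. An orthonormal frame is a basis, so a germ
eventually lies strictly on one side of every line (`mem_refinedHalfSpace_or_neg`). Hence it ignores
finite unions of lines and decides membership in every polyhedral set. The refinement of a polygon P
turns out to be the set of germs lying in P (`refinement_eq_germSet`). Closure under √(1+x²) matters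
only there: it allows a frame at a boundary point to be aimed at an interior point. Partitions of
refinements thus become partitions in the plane up to finitely many lines
(`isRefinedPartition_iff`).

Area is additive over such partitions, because lines are null and closures of almost disjoint
polyhedral sets overlap in a null set (`Polyhedral.closure_inter_null`). It is invariant under
isometries, which are orthogonal affine maps. So equidecomposability implies equal area.

For the converse, translations and point reflections suffice. They form a group normalised by all
affine bijections, so the resulting scissors congruence is affinely invariant
(`ScissorsCongruent.image`). Reduction of the first coordinate mod 1 turns a sheared unit square
into the unit square, and column reduction then brings every parallelogram to some [0,1) × [0,r). A
triangle is scissors congruent to a parallelogram, a bounded polyhedral set is a union of triangles,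
and rectangles of width 1 can be stacked. The height r is the area, so sets of equal area share a
normal form (`scissorsCongruent_of_area_eq`). -/

noncomputable section

namespace RefinedGeometry

open Filter Set MeasureTheory

variable {F : Subfield ℝ}

/-! ### Affine functionals in coordinates -/

/-- The affine functional `x ↦ a x₀ + b x₁ + c`. -/
def functional (a b c : F) : Space F 2 →ᵃ[F] F where
  toFun x := a * x 0 + b * x 1 + c
  linear := a • LinearMap.proj 0 + b • LinearMap.proj 1
  map_vadd' x v := by simp; ring

@[simp]
theorem functional_apply (a b c : F) (x : Space F 2) :
    functional a b c x = a * x 0 + b * x 1 + c := rfl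

theorem functional_linear_apply (a b c : F) (x : Space F 2) :
    (functional a b c).linear x = a * x 0 + b * x 1 := by
  simp [functional]

theorem regular_functional {a b : F} (c : F) (h : a ≠ 0 ∨ b ≠ 0) :
    Regular (functional a b c) := by
  intro h0
  have h1 := congrArg (fun l => l ![1, 0]) h0
  have h2 := congrArg (fun l => l ![0, 1]) h0
  simp [functional_linear_apply] at h1 h2
  tauto

theorem exists_eq_functional (ξ : Space F 2 →ᵃ[F] F) :
    ∃ a b c : F, ξ = functional a b c := by
  refine ⟨ξ.linear ![1, 0], ξ.linear ![0, 1], ξ 0, ?_⟩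
  refine AffineMap.ext fun x => ?_
  have h1 : ξ x = ξ.linear x + ξ 0 := by
    have := ξ.map_vadd 0 x
    simpa using this
  have h2 : x = x 0 • ![1, 0] + x 1 • ![0, 1] := by
    ext i; fin_cases i <;> simp
  rw [h1, functional_apply]
  conv_lhs => rw [h2]
  rw [map_add, map_smul, map_smul]
  simp only [smul_eq_mul]
  congr 1
  ring_nf

theorem exists_eq_functional_of_regular {ξ : Space F 2 →ᵃ[F] F} (hξ : Regular ξ) :
    ∃ a b c : F, ξ = functional a b c ∧ (a ≠ 0 ∨ b ≠ 0) := by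
  obtain ⟨a, b, c, rfl⟩ := exists_eq_functional ξ
  refine ⟨a, b, c, rfl, ?_⟩
  by_contra! h
  obtain ⟨rfl, rfl⟩ := h
  exact hξ (by ext x : 1; simp [functional])

theorem Regular.comp {ξ : Space F 2 →ᵃ[F] F} (h : Regular ξ)
    (φ : Space F 2 ≃ᵃ[F] Space F 2) : Regular (ξ.comp φ.toAffineMap) := by
  intro h0
  apply h
  refine LinearMap.ext fun v => ?_
  have := congrArg (fun l => l (φ.linear.symm v)) h0
  simpa using this

/-! ### Generic points -/

/-- The filter of properties that hold outside a finite union of lines. -/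
def generic (F : Subfield ℝ) : Filter (Space F 2) :=
  ⨅ (ξ : Space F 2 →ᵃ[F] F) (_ : Regular ξ), 𝓟 {x | ξ x ≠ 0}

theorem Regular.eventually_ne {ξ : Space F 2 →ᵃ[F] F} (h : Regular ξ) :
    ∀ᶠ x in generic F, ξ x ≠ 0 :=
  mem_iInf_of_mem ξ (mem_iInf_of_mem h (mem_principal_self _))

theorem eventually_generic_ne {Ξ : Set (Space F 2 →ᵃ[F] F)} (hf : Ξ.Finite)
    (hΞ : ∀ ξ ∈ Ξ, Regular ξ) : ∀ᶠ x in generic F, ∀ ξ ∈ Ξ, ξ x ≠ 0 :=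
  (eventually_all_finite hf).2 fun ξ h => (hΞ ξ h).eventually_ne

theorem tendsto_generic (φ : Space F 2 ≃ᵃ[F] Space F 2) :
    Tendsto φ (generic F) (generic F) := by
  refine tendsto_iInf.2 fun ξ => tendsto_iInf.2 fun h => tendsto_principal.2 ?_
  exact (h.comp φ).eventually_ne

/-! ### Polyhedral sets -/

/-- A set is polyhedral if membership of a point depends only on its position with respect to
finitely many lines. -/
def Polyhedral (S : Set (Space F 2)) : Prop :=
  ∃ Ξ : Set (Space F 2 →ᵃ[F] F), Ξ.Finite ∧ (∀ ξ ∈ Ξ, Regular ξ) ∧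
    ∀ x y, (∀ ξ ∈ Ξ, SignType.sign (ξ x) = SignType.sign (ξ y)) → (x ∈ S ↔ y ∈ S)

theorem Polyhedral.compl {S : Set (Space F 2)} (h : Polyhedral S) : Polyhedral Sᶜ := by
  obtain ⟨Ξ, hf, hr, h⟩ := h
  exact ⟨Ξ, hf, hr, fun x y hxy => not_congr (h x y hxy)⟩

theorem Polyhedral.inter {S T : Set (Space F 2)} (hS : Polyhedral S) (hT : Polyhedral T) :
    Polyhedral (S ∩ T) := by
  obtain ⟨Ξ, hf, hr, h⟩ := hS
  obtain ⟨Ξ', hf', hr', h'⟩ := hT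
  refine ⟨Ξ ∪ Ξ', hf.union hf', ?_, fun x y hxy => and_congr ?_ ?_⟩
  · rintro ξ (hξ | hξ)
    exacts [hr ξ hξ, hr' ξ hξ]
  · exact h x y fun ξ hξ => hxy ξ (Or.inl hξ)
  · exact h' x y fun ξ hξ => hxy ξ (Or.inr hξ)

theorem polyhedral_empty : Polyhedral (∅ : Set (Space F 2)) :=
  ⟨∅, finite_empty, by simp, by simp⟩

theorem Polyhedral.union {S T : Set (Space F 2)} (hS : Polyhedral S) (hT : Polyhedral T) :
    Polyhedral (S ∪ T) := by
  rw [← compl_compl (S ∪ T), compl_union]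
  exact (hS.compl.inter hT.compl).compl

theorem Polyhedral.sUnion {𝒞 : Set (Set (Space F 2))} (hf : 𝒞.Finite)
    (h : ∀ C ∈ 𝒞, Polyhedral C) : Polyhedral (⋃₀ 𝒞) := by
  induction 𝒞, hf using Set.Finite.induction_on with
  | empty => simpa using polyhedral_empty
  | insert _ _ ih =>
    rw [sUnion_insert]
    exact (h _ (mem_insert _ _)).union (ih fun C hC => h C (mem_insert_of_mem _ hC))

theorem Polyhedral.preimage {S : Set (Space F 2)} (hS : Polyhedral S)
    (φ : Space F 2 ≃ᵃ[F] Space F 2) : Polyhedral (φ ⁻¹' S) := by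
  obtain ⟨Ξ, hf, hr, h⟩ := hS
  refine ⟨(fun ξ : Space F 2 →ᵃ[F] F => ξ.comp φ.toAffineMap) '' Ξ, hf.image _, ?_, ?_⟩
  · rintro _ ⟨ξ, hξ, rfl⟩
    exact (hr ξ hξ).comp φ
  · intro x y hxy
    exact h _ _ fun ξ hξ => hxy _ (mem_image_of_mem _ hξ)

theorem Polyhedral.image {S : Set (Space F 2)} (hS : Polyhedral S)
    (φ : Space F 2 ≃ᵃ[F] Space F 2) : Polyhedral (φ '' S) := by
  have : φ '' S = φ.symm ⁻¹' S := φ.toEquiv.image_eq_preimage_symm S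
  rw [this]
  exact hS.preimage φ.symm

theorem polyhedral_closedHalfSpace {ξ : Space F 2 →ᵃ[F] F} (h : Regular ξ) :
    Polyhedral (closedHalfSpace ξ) := by
  refine ⟨{ξ}, finite_singleton _, by simpa using h, fun x y hxy => ?_⟩
  have := hxy ξ rfl
  simp only [closedHalfSpace, mem_ofPred_eq]
  rw [← sign_nonneg_iff, this, sign_nonneg_iff]

theorem polyhedral_biInter_closedHalfSpace {Ξ : Finset (Space F 2 →ᵃ[F] F)}
    (h : ∀ ξ ∈ Ξ, Regular ξ) : Polyhedral (⋂ ξ ∈ Ξ, closedHalfSpace ξ) := by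
  refine ⟨Ξ, Ξ.finite_toSet, h, fun x y hxy => ?_⟩
  simp only [closedHalfSpace, mem_iInter, mem_ofPred_eq]
  refine forall₂_congr fun ξ hξ => ?_
  rw [← sign_nonneg_iff, hxy ξ hξ, sign_nonneg_iff]

theorem IsConvexPolytope.polyhedral {C : Set (Space F 2)} (h : IsConvexPolytope C) :
    Polyhedral C := by
  obtain ⟨-, Ξ, hΞ, rfl⟩ := h
  exact polyhedral_biInter_closedHalfSpace hΞ

theorem IsPolygon.polyhedral {P : Set (Space F 2)} (h : IsPolygon P) : Polyhedral P := by
  obtain ⟨𝒞, hf, hC, rfl⟩ := h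
  exact Polyhedral.sUnion hf fun C h => (hC C h).1.polyhedral

/-! ### Germs at points of the refined plane -/

/-- The filter of sets that contain `x + ε ρ₀ + δ ρ₁` for all small `ε > 0` and all `δ > 0` that are
small in comparison with `ε`. -/
def germ (z : RefinedSpace F 2) : Filter (Space F 2) :=
  -- The small parameters are ε = s⁻¹ and δ = t⁻¹; `bind` lets the threshold for t depend on s.
  atTop.bind fun s : F => atTop.map fun t : F => z.1 + s⁻¹ • z.2.1 0 + t⁻¹ • z.2.1 1

theorem eventually_germ {z : RefinedSpace F 2} {p : Space F 2 → Prop} :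
    (∀ᶠ x in germ z, p x) ↔
      ∀ᶠ s : F in atTop, ∀ᶠ t : F in atTop, p (z.1 + s⁻¹ • z.2.1 0 + t⁻¹ • z.2.1 1) := Iff.rfl

instance (z : RefinedSpace F 2) : (germ z).NeBot := by
  rw [neBot_iff]
  intro h
  have h0 : ∀ᶠ x in germ z, False := by rw [h]; exact mem_bot
  obtain ⟨s, hs⟩ := (eventually_germ.1 h0).exists
  exact hs.exists.elim fun _ h => h

theorem map_add_eq (ξ : Space F 2 →ᵃ[F] F) (x v : Space F 2) :
    ξ (x + v) = ξ x + ξ.linear v := by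
  have := ξ.map_vadd x v
  rw [vadd_eq_add, vadd_eq_add] at this
  rw [add_comm x, this, add_comm]

/-- An entry matters only when all earlier ones vanish, so the values at partial sums can be
replaced by the increments of ξ along the frame. -/
theorem lexPos_refineFunctional_iff {ξ : Space F 2 →ᵃ[F] F} {x : Space F 2}
    {v : Fin 2 → Space F 2} :
    LexPos (refineFunctional ξ x v) ↔
      0 < ξ x ∨ (ξ x = 0 ∧ (0 < ξ.linear (v 0) ∨ (ξ.linear (v 0) = 0 ∧ 0 < ξ.linear (v 1)))) := by
  have h0 : refineFunctional ξ x v 0 = ξ x := by simp [refineFunctional]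
  have h1 : refineFunctional ξ x v 1 = ξ x + ξ.linear (v 0) := by
    rw [refineFunctional, ← map_add_eq]
    simp [Finset.sum_filter]
  have h2 : refineFunctional ξ x v 2 = ξ x + ξ.linear (v 0) + ξ.linear (v 1) := by
    rw [refineFunctional, ← map_add_eq, ← map_add_eq]
    simp [Finset.sum_filter, Fin.sum_univ_two, add_assoc, Fin.lt_def]
  rw [LexPos, Fin.exists_fin_succ, Fin.exists_fin_two]
  have l2 : ∀ i : Fin 3, i < 2 ↔ i = 0 ∨ i = 1 := by decide
  have l1 : ∀ i : Fin 3, i < 1 ↔ i = 0 := by decide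
  simp only [Fin.succ_zero_eq_one, Fin.succ_one_eq_two, l2, l1, forall_eq_or_imp, forall_eq, h0, h1,
    h2, Fin.not_lt_zero, IsEmpty.forall_iff, implies_true, and_true]
  constructor
  · rintro (h | ⟨h, h'⟩ | ⟨h, h', h''⟩)
    · exact Or.inl h
    · rw [h', zero_add] at h
      exact Or.inr ⟨h', Or.inl h⟩
    · rw [h', zero_add] at h''
      rw [h', h'', zero_add, zero_add] at h
      exact Or.inr ⟨h', Or.inr ⟨h'', h⟩⟩
  · rintro (h | ⟨h, h' | ⟨h', h''⟩⟩)
    · exact Or.inl h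
    · exact Or.inr (Or.inl ⟨by simpa [h] using h', h⟩)
    · exact Or.inr (Or.inr ⟨by simpa [h, h'] using h'', by simp [h], by simp [h, h']⟩)

theorem eventually_add_inv_mul_pos {a : F} (ha : 0 < a) (b : F) :
    ∀ᶠ s : F in atTop, 0 < a + s⁻¹ * b := by
  filter_upwards [eventually_gt_atTop 0, eventually_gt_atTop (-b / a)] with s hs hs'
  rw [div_lt_iff₀ ha] at hs'
  have : a + s⁻¹ * b = s⁻¹ * (s * a + b) := by field_simp
  rw [this]
  exact mul_pos (inv_pos.2 hs) (by linarith)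

/-- Along x + ερ₁ + δρ₂ with δ ≪ ε ≪ 1, the first nonzero one among ξ(x) and the two increments
dominates. This is what lexicographic positivity measures. -/
theorem eventually_germ_pos {ξ : Space F 2 →ᵃ[F] F} {z : RefinedSpace F 2}
    (h : z ∈ refinedHalfSpace ξ) : ∀ᶠ x in germ z, 0 < ξ x := by
  simp only [eventually_germ, map_add_eq, map_smul, smul_eq_mul]
  rcases lexPos_refineFunctional_iff.1 h with h | ⟨h, h' | ⟨h', h''⟩⟩
  · filter_upwards [eventually_add_inv_mul_pos h (ξ.linear (z.2.1 0))] with s hs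
    exact eventually_add_inv_mul_pos hs _
  · filter_upwards [eventually_gt_atTop 0] with s hs
    rw [h, zero_add]
    exact eventually_add_inv_mul_pos (mul_pos (inv_pos.2 hs) h') _
  · refine Eventually.of_forall fun s => ?_
    filter_upwards [eventually_gt_atTop 0] with t ht
    rw [h, h', mul_zero, zero_add, zero_add]
    exact mul_pos (inv_pos.2 ht) h''

/-- A tie would require the linear part of ξ to kill both frame vectors. These form a basis, so ξ
would be constant. -/
theorem mem_refinedHalfSpace_or_neg {ξ : Space F 2 →ᵃ[F] F} (hξ : Regular ξ)
    (z : RefinedSpace F 2) : z ∈ refinedHalfSpace ξ ∨ z ∈ refinedHalfSpace (-ξ) := by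
  simp only [refinedHalfSpace, mem_ofPred_eq, lexPos_refineFunctional_iff]
  simp only [AffineMap.neg_linear, AffineMap.coe_neg, Pi.neg_apply, LinearMap.neg_apply,
    Left.neg_pos_iff, neg_eq_zero]
  rcases lt_trichotomy (ξ z.1) 0 with h | h | h
  · exact Or.inr (Or.inl h)
  · rcases lt_trichotomy (ξ.linear (z.2.1 0)) 0 with h' | h' | h'
    · exact Or.inr (Or.inr ⟨h, Or.inl h'⟩)
    · rcases lt_trichotomy (ξ.linear (z.2.1 1)) 0 with h'' | h'' | h''
      · exact Or.inr (Or.inr ⟨h, Or.inr ⟨h', h''⟩⟩)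
      · exfalso
        obtain ⟨a, b, c, rfl, hab⟩ := exists_eq_functional_of_regular hξ
        have h0 := z.2.2 0 0
        have h1 := z.2.2 1 1
        have h01 := z.2.2 0 1
        simp only [functional_linear_apply] at h' h''
        simp only [dotProduct, Fin.sum_univ_two, if_true, Fin.zero_eq_one_iff,
          OfNat.ofNat_ne_one, if_false] at h0 h1 h01
        generalize z.2.1 0 0 = p at *
        generalize z.2.1 0 1 = q at *
        generalize z.2.1 1 0 = r at *
        generalize z.2.1 1 1 = s at *
        -- Lagrange's identity: the squared determinant is the Gram determinant of the frame.
        -- Cramer's rule then yields the contradiction.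
        have hd : (p * s - q * r) ^ 2 = 1 := by
          linear_combination (s * s + r * r) * h0 + h1 - (p * r + q * s) * h01
        have hd0 : p * s - q * r ≠ 0 := by
          intro h0
          rw [h0] at hd
          norm_num at hd
        rcases hab with hab | hab
        · apply mul_ne_zero hab hd0
          linear_combination s * h' - q * h''
        · apply mul_ne_zero hab hd0
          linear_combination p * h'' - r * h'
      · exact Or.inl (Or.inr ⟨h, Or.inr ⟨h', h''⟩⟩)
    · exact Or.inl (Or.inr ⟨h, Or.inl h'⟩)
  · exact Or.inl (Or.inl h)

theorem germ_le_generic (z : RefinedSpace F 2) : germ z ≤ generic F := by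
  refine le_iInf₂ fun ξ hξ => le_principal_iff.2 ?_
  rcases mem_refinedHalfSpace_or_neg hξ z with h | h
  · filter_upwards [eventually_germ_pos h] with x hx using hx.ne'
  · filter_upwards [eventually_germ_pos h] with x hx
    simpa using hx.ne'

/-- The second clause links germs to points: off the line, every germ at a point carries the sign of
the point itself, whatever the frame. -/
theorem exists_sign_germ {ξ : Space F 2 →ᵃ[F] F} (hξ : Regular ξ) (z : RefinedSpace F 2) :
    ∃ σ : SignType, (∀ᶠ x in germ z, SignType.sign (ξ x) = σ) ∧
      (ξ z.1 ≠ 0 → SignType.sign (ξ z.1) = σ) := by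
  rcases mem_refinedHalfSpace_or_neg hξ z with h | h
  · refine ⟨1, ?_, fun h0 => sign_pos ?_⟩
    · filter_upwards [eventually_germ_pos h] with x hx using sign_pos hx
    · rcases lexPos_refineFunctional_iff.1 h with h | ⟨h, -⟩
      exacts [h, absurd h h0]
  · refine ⟨-1, ?_, fun h0 => sign_neg ?_⟩
    · filter_upwards [eventually_germ_pos h] with x hx
      exact sign_neg (by simpa using hx)
    · rcases lexPos_refineFunctional_iff.1 h with h | ⟨h, -⟩
      · simpa using h
      · exact absurd (by simpa using h) h0

/-- The finitely many signs on which `S` depends are eventually constant along the germ. So a germ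
behaves like an ultrafilter on polyhedral sets. -/
theorem Polyhedral.mem_germ_or_compl {S : Set (Space F 2)} (hS : Polyhedral S)
    (z : RefinedSpace F 2) : S ∈ germ z ∨ Sᶜ ∈ germ z := by
  obtain ⟨Ξ, hf, hr, h⟩ := hS
  have hσ : ∀ ξ : Space F 2 →ᵃ[F] F, ∃ σ : SignType,
      ξ ∈ Ξ → ∀ᶠ x in germ z, SignType.sign (ξ x) = σ := by
    intro ξ
    by_cases hξ : ξ ∈ Ξ
    · obtain ⟨σ, hσ, -⟩ := exists_sign_germ (hr ξ hξ) z
      exact ⟨σ, fun _ => hσ⟩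
    · exact ⟨0, fun h => absurd h hξ⟩
  choose σ hσ using hσ
  have key : ∀ᶠ x in germ z, ∀ ξ ∈ Ξ, SignType.sign (ξ x) = σ ξ :=
    (eventually_all_finite hf).2 hσ
  obtain ⟨y, hy⟩ := key.exists
  by_cases hyS : y ∈ S
  · left
    filter_upwards [key] with x hx
    exact (h x y fun ξ hξ => (hx ξ hξ).trans (hy ξ hξ).symm).2 hyS
  · right
    filter_upwards [key] with x hx
    exact fun hxS => hyS ((h x y fun ξ hξ => (hx ξ hξ).trans (hy ξ hξ).symm).1 hxS)

/-- Off the lines that define `S`, a germ stays in the sign cell of its base point. Thus `S` can be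
recovered from `germSet S` up to lines. -/
theorem Polyhedral.eventually_mem_germ_iff {S : Set (Space F 2)} (hS : Polyhedral S) :
    ∀ᶠ x in generic F, ∀ ρ : Resolution F 2, S ∈ germ (x, ρ) ↔ x ∈ S := by
  obtain ⟨Ξ, hf, hr, h⟩ := hS
  filter_upwards [eventually_generic_ne hf hr] with x hx ρ
  have key : ∀ᶠ y in germ (x, ρ), ∀ ξ ∈ Ξ, SignType.sign (ξ y) = SignType.sign (ξ x) := by
    refine (eventually_all_finite hf).2 fun ξ hξ => ?_
    obtain ⟨σ, hσ, hσ'⟩ := exists_sign_germ (hr ξ hξ) (x, ρ)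
    rwa [hσ' (hx ξ hξ)]
  have key' : ∀ᶠ y in germ (x, ρ), (y ∈ S ↔ x ∈ S) := key.mono fun y hy => h y x hy
  constructor
  · intro hS
    obtain ⟨y, hy, hyS⟩ := (key'.and hS).exists
    exact hy.1 hyS
  · intro hxS
    filter_upwards [key'] with y hy using hy.2 hxS

/-! ### The refinement of a polygon -/

/-- The points of the refined plane whose germ lies in `S`. -/
def germSet (S : Set (Space F 2)) : Set (RefinedSpace F 2) :=
  {z | S ∈ germ z}

theorem germSet_congr {S T : Set (Space F 2)} (h : S =ᶠ[generic F] T) :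
    germSet S = germSet T := by
  ext z
  exact congr_sets (f := germ z) (h.filter_mono (germ_le_generic z)).mem_iff

theorem germSet_closedHalfSpace {ξ : Space F 2 →ᵃ[F] F} (hξ : Regular ξ) :
    germSet (closedHalfSpace ξ) = refinedHalfSpace ξ := by
  ext z
  constructor
  · intro h
    refine (mem_refinedHalfSpace_or_neg hξ z).resolve_right fun h' => ?_
    obtain ⟨x, hx, hx'⟩ := ((eventually_germ_pos h').and h).exists
    have h1 : 0 < -ξ x := hx
    have h2 : 0 ≤ ξ x := hx'
    linarith
  · intro h
    exact (eventually_germ_pos h).mono fun x hx => le_of_lt hx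

theorem germSet_biInter_closedHalfSpace {Ξ : Finset (Space F 2 →ᵃ[F] F)}
    (h : ∀ ξ ∈ Ξ, Regular ξ) :
    germSet (⋂ ξ ∈ Ξ, closedHalfSpace ξ) = ⋂ ξ ∈ Ξ, refinedHalfSpace ξ := by
  ext z
  have : z ∈ germSet (⋂ ξ ∈ Ξ, closedHalfSpace ξ) ↔ ∀ ξ ∈ Ξ, z ∈ germSet (closedHalfSpace ξ) :=
    biInter_finset_mem (f := germ z) Ξ
  rw [this]
  simp only [mem_iInter]
  exact forall₂_congr fun ξ hξ => by rw [germSet_closedHalfSpace (h ξ hξ)]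

/-- The forward direction fails for general filters; it holds because a germ missing each of
finitely many polyhedral sets contains all their complements. -/
theorem mem_germSet_sUnion {𝒞 : Set (Set (Space F 2))} (hf : 𝒞.Finite)
    (h : ∀ C ∈ 𝒞, Polyhedral C) (z : RefinedSpace F 2) :
    z ∈ germSet (⋃₀ 𝒞) ↔ ∃ C ∈ 𝒞, z ∈ germSet C := by
  constructor
  · intro hz
    by_contra! hC
    have : ∀ᶠ x in germ z, ∀ C ∈ 𝒞, x ∈ Cᶜ :=
      (eventually_all_finite hf).2 fun C hC' =>
        ((h C hC').mem_germ_or_compl z).resolve_left (hC C hC')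
    obtain ⟨x, hx, C, hC, hxC⟩ := (this.and hz).exists
    exact hx C hC hxC
  · rintro ⟨C, hC, hz⟩
    exact mem_of_superset (f := germ z) hz (subset_sUnion_of_mem hC)

theorem IsRefinedPolytope.exists_eq_germSet {S : Set (RefinedSpace F 2)}
    (h : IsRefinedPolytope S) : ∃ P : Set (Space F 2), Polyhedral P ∧ S = germSet P := by
  obtain ⟨𝒮, hf, hC, rfl⟩ := h
  have hP : ∀ C : Set (RefinedSpace F 2), ∃ P : Set (Space F 2),
      C ∈ 𝒮 → Polyhedral P ∧ C = germSet P := by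
    intro C
    by_cases hCS : C ∈ 𝒮
    · obtain ⟨Ξ, hΞ, rfl⟩ := hC C hCS
      exact ⟨_, fun _ => ⟨polyhedral_biInter_closedHalfSpace hΞ,
        (germSet_biInter_closedHalfSpace hΞ).symm⟩⟩
    · exact ⟨∅, fun h => absurd h hCS⟩
  choose p hp using hP
  have hpol : ∀ C ∈ p '' 𝒮, Polyhedral C := by
    rintro _ ⟨C, hC, rfl⟩
    exact (hp C hC).1
  refine ⟨⋃₀ (p '' 𝒮), Polyhedral.sUnion (hf.image p) hpol, ?_⟩
  ext z
  rw [mem_germSet_sUnion (hf.image p) hpol]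
  simp only [mem_sUnion, exists_mem_image]
  exact exists_congr fun C => and_congr_right fun hC => by rw [← (hp C hC).2]

theorem closing_germSet_eventuallyEq {P : Set (Space F 2)} (hP : Polyhedral P)
    (ρ : Resolution F 2) : closing '' germSet P =ᶠ[generic F] P := by
  filter_upwards [hP.eventually_mem_germ_iff] with x hx
  apply propext
  constructor
  · rintro ⟨⟨_, ρ'⟩, h, rfl⟩
    exact (hx ρ').1 h
  · intro h
    exact ⟨(x, ρ), (hx ρ).2 h, rfl⟩

/-- The standard basis. -/
def stdResolution (F : Subfield ℝ) : Resolution F 2 :=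
  ⟨![![1, 0], ![0, 1]], by intro i j; fin_cases i <;> fin_cases j <;> simp⟩

/-- Produces an interior point. No bounding functional vanishes on all of `C`, since its linear part
would kill the whole plane; midpoints then combine the witnesses for the single functionals. -/
theorem exists_forall_pos_of_rank_eq_two {C : Set (Space F 2)} (hne : C.Nonempty)
    (hrank : rank C = 2) {Ξ : Finset (Space F 2 →ᵃ[F] F)} (hΞ : ∀ ξ ∈ Ξ, Regular ξ)
    (hC : C = ⋂ ξ ∈ Ξ, closedHalfSpace ξ) : ∃ c ∈ C, ∀ ξ ∈ Ξ, 0 < ξ c := by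
  have hmem : ∀ x, x ∈ C ↔ ∀ ξ ∈ Ξ, 0 ≤ ξ x := by
    intro x
    rw [hC]
    simp [closedHalfSpace]
  have hpos : ∀ ξ ∈ Ξ, ∃ x ∈ C, 0 < ξ x := by
    intro ξ hξ
    by_contra! h
    have h0 : ∀ x ∈ C, ξ x = 0 := fun x hx => le_antisymm (h x hx) ((hmem x).1 hx ξ hξ)
    apply hΞ ξ hξ
    have htop : (affineSpan F C).direction = ⊤ := by
      apply Submodule.eq_top_of_finrank_eq
      rw [Module.finrank_fin_fun]
      exact hrank
    rw [← LinearMap.ker_eq_top, eq_top_iff, ← htop, direction_affineSpan, vectorSpan,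
      Submodule.span_le]
    rintro _ ⟨x, hx, y, hy, rfl⟩
    have := ξ.linearMap_vsub x y
    simpa [h0 x hx, h0 y hy, -map_sub] using this
  have key : ∀ Ξ' : Finset (Space F 2 →ᵃ[F] F), Ξ' ⊆ Ξ → ∃ c ∈ C, ∀ ξ ∈ Ξ', 0 < ξ c := by
    classical
    intro Ξ'
    induction Ξ' using Finset.induction_on with
    | empty => exact fun _ => ⟨hne.choose, hne.choose_spec, by simp⟩
    | insert ξ Ξ' _ ih =>
      intro hsub
      obtain ⟨c, hcC, hc⟩ := ih ((Finset.subset_insert _ _).trans hsub)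
      obtain ⟨d, hdC, hd⟩ := hpos ξ (hsub (Finset.mem_insert_self _ _))
      have hmid : ∀ η : Space F 2 →ᵃ[F] F, η (AffineMap.lineMap c d (1 / 2 : F)) =
          (η c + η d) / 2 := by
        intro η
        rw [AffineMap.apply_lineMap, AffineMap.lineMap_apply]
        simp only [vsub_eq_sub, smul_eq_mul, vadd_eq_add]
        ring
      refine ⟨AffineMap.lineMap c d (1 / 2 : F), ?_, ?_⟩
      · rw [hmem]
        intro η hη
        have h1 := (hmem c).1 hcC η hη
        have h2 := (hmem d).1 hdC η hη
        rw [hmid]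
        positivity
      · intro η hη
        rw [hmid]
        rcases Finset.mem_insert.1 hη with rfl | hη'
        · have := (hmem c).1 hcC η (hsub hη)
          positivity
        · have h1 := hc η hη'
          have h2 := (hmem d).1 hdC η (hsub hη)
          positivity
  exact key Ξ Subset.rfl

/-- The first vector of an orthonormal frame can be chosen in the direction of any vector. -/
theorem exists_resolution_smul_eq (hF : ∀ x ∈ F, √(1 + x ^ 2) ∈ F) {v : Space F 2}
    (hv : v ≠ 0) : ∃ (ρ : Resolution F 2) (r : F), 0 < r ∧ v = r • ρ.1 0 := by
  obtain ⟨r, hr, hrv⟩ : ∃ r : F, 0 < r ∧ r * r = v 0 * v 0 + v 1 * v 1 := by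
    by_cases h0 : v 0 = 0
    · have h1 : v 1 ≠ 0 := by
        intro h1
        apply hv
        ext i
        fin_cases i <;> simp [h0, h1]
      exact ⟨|v 1|, abs_pos.2 h1, by rw [h0, abs_mul_abs_self]; ring⟩
    -- The norm of v is |v₀| √(1 + (v₁/v₀)²), which lies in F by the closure hypothesis.
    · let s : F := ⟨_, hF _ (v 1 / v 0).2⟩
      have hs : s * s = 1 + (v 1 / v 0) ^ 2 := by
        apply Subtype.ext
        have : (0 : ℝ) ≤ 1 + ((v 1 / v 0 : F) : ℝ) ^ 2 := by positivity
        simpa [s] using Real.mul_self_sqrt this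
      have hs0 : 0 < s := by
        have : (0 : ℝ) < √(1 + ((v 1 / v 0 : F) : ℝ) ^ 2) := by positivity
        exact this
      refine ⟨|v 0| * s, mul_pos (abs_pos.2 h0) hs0, ?_⟩
      have h1 := abs_mul_abs_self (v 0)
      calc |v 0| * s * (|v 0| * s) = (|v 0| * |v 0|) * (s * s) := by ring
        _ = _ := by rw [h1, hs]; field_simp
  refine ⟨⟨![![v 0 / r, v 1 / r], ![-(v 1 / r), v 0 / r]], ?_⟩, r, hr, ?_⟩
  · have hr0 := hr.ne'
    have h1 : v 0 / r * (v 0 / r) + v 1 / r * (v 1 / r) = 1 := by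
      field_simp
      linear_combination -hrv
    intro i j
    fin_cases i <;> fin_cases j <;> simp
    exacts [h1, by ring, by ring, by linear_combination h1]
  · ext i
    have hr0 := hr.ne'
    fin_cases i <;> simp [mul_div_cancel₀, hr0]

/-- At a point of `C`, aim the first frame vector at an interior point `c`: each functional
vanishing there increases in that direction, so the germ enters `C`. -/
theorem closing_germSet_of_isConvexPolytope (hF : ∀ x ∈ F, √(1 + x ^ 2) ∈ F)
    {C : Set (Space F 2)} (h : IsConvexPolytope C) (hne : C.Nonempty) (hrank : rank C = 2) :
    closing '' germSet C = C := by
  obtain ⟨-, Ξ, hΞ, hC⟩ := h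
  obtain ⟨c, hcC, hc⟩ := exists_forall_pos_of_rank_eq_two hne hrank hΞ hC
  have hmem : ∀ x, x ∈ C ↔ ∀ ξ ∈ Ξ, 0 ≤ ξ x := by
    intro x
    rw [hC]
    simp [closedHalfSpace]
  have hg : germSet C = ⋂ ξ ∈ Ξ, refinedHalfSpace ξ := by
    rw [hC, germSet_biInter_closedHalfSpace hΞ]
  ext x
  constructor
  · rintro ⟨z, hz, rfl⟩
    rw [hmem]
    intro ξ hξ
    rw [hg] at hz
    simp only [mem_iInter] at hz
    rcases lexPos_refineFunctional_iff.1 (hz ξ hξ) with h | ⟨h, -⟩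
    exacts [h.le, h.ge]
  · intro hx
    by_cases hxc : c = x
    · subst hxc
      refine ⟨(c, stdResolution F), ?_, rfl⟩
      rw [hg]
      simp only [mem_iInter]
      exact fun ξ hξ => lexPos_refineFunctional_iff.2 (Or.inl (hc ξ hξ))
    · obtain ⟨ρ, r, hr, hρ⟩ := exists_resolution_smul_eq hF (sub_ne_zero.2 hxc)
      refine ⟨(x, ρ), ?_, rfl⟩
      rw [hg]
      simp only [mem_iInter]
      refine fun ξ hξ => lexPos_refineFunctional_iff.2 ?_
      rcases ((hmem x).1 hx ξ hξ).lt_or_eq with h | h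
      · exact Or.inl h
      · refine Or.inr ⟨h.symm, Or.inl ?_⟩
        have h1 : ξ.linear (c - x) = ξ c - ξ x := by
          have := map_add_eq ξ x (c - x)
          rw [add_sub_cancel] at this
          rw [this, add_sub_cancel_left]
        rw [hρ, map_smul, ← h, sub_zero, smul_eq_mul] at h1
        exact (mul_pos_iff_of_pos_left hr).1 (h1 ▸ hc ξ hξ)

/-- Existence: `germSet P` closes to `P`, convex piece by convex piece. Uniqueness: any refined
polytope is `germSet P'`, its closing agrees with `P'` off finitely many lines, and germs do not see
lines. -/
theorem refinement_eq_germSet (hF : ∀ x ∈ F, √(1 + x ^ 2) ∈ F) {P : Set (Space F 2)}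
    (hP : IsPolygon P) : refinement P = germSet P := by
  have hpol := hP.polyhedral
  have hex : ∃ S ∈ {S : Set (RefinedSpace F 2) | IsRefinedPolytope S}, closing '' S = P := by
    obtain ⟨𝒞, hf, hC, rfl⟩ := hP
    refine ⟨germSet (⋃₀ 𝒞), ⟨germSet '' 𝒞, hf.image _, ?_, ?_⟩, ?_⟩
    · rintro _ ⟨C, hC', rfl⟩
      obtain ⟨-, Ξ, hΞ, rfl⟩ := (hC C hC').1
      exact ⟨Ξ, hΞ, germSet_biInter_closedHalfSpace hΞ⟩
    · ext z
      rw [mem_germSet_sUnion hf fun C h => (hC C h).1.polyhedral]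
      simp
    · have : germSet (⋃₀ 𝒞) = ⋃ C ∈ 𝒞, germSet C := by
        ext z
        rw [mem_germSet_sUnion hf fun C h => (hC C h).1.polyhedral]
        simp
      rw [this, image_iUnion₂, sUnion_eq_biUnion]
      exact iUnion₂_congr fun C h =>
        closing_germSet_of_isConvexPolytope hF (hC C h).1 (hC C h).2.1 (hC C h).2.2
  have hmem := Function.invFunOn_mem hex
  have heq : closing '' refinement P = P := Function.invFunOn_eq hex
  obtain ⟨P', hP', h⟩ := IsRefinedPolytope.exists_eq_germSet hmem
  change refinement P = germSet P' at h
  rw [h] at heq ⊢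
  have := closing_germSet_eventuallyEq hP' (stdResolution F)
  rw [heq] at this
  exact (germSet_congr this).symm

/-! ### Area -/

/-- The inclusion of `F ^ 2` in `ℝ ^ 2`. -/
def toReal (x : Space F 2) (i : Fin 2) : ℝ := (x i : ℝ)

theorem area_eq (S : Set (Space F 2)) : area S = volume (closure (toReal '' S)) := rfl

theorem area_mono {S T : Set (Space F 2)} (h : S ⊆ T) : area S ≤ area T :=
  measure_mono (closure_mono (image_mono h))

theorem area_union_le (S T : Set (Space F 2)) : area (S ∪ T) ≤ area S + area T := by
  rw [area_eq, image_union, closure_union]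
  exact measure_union_le _ _

/-- The zero set in `ℝ ^ 2` of `y ↦ a y₀ + b y₁ + c`. -/
def realLine (a b c : ℝ) : Set (Fin 2 → ℝ) := {y | a * y 0 + b * y 1 + c = 0}

theorem isClosed_realLine (a b c : ℝ) : IsClosed (realLine a b c) :=
  isClosed_eq (by fun_prop) continuous_const

theorem volume_realLine {a b : ℝ} (c : ℝ) (h : a ≠ 0 ∨ b ≠ 0) : volume (realLine a b c) = 0 := by
  let f : (Fin 2 → ℝ) →ᵃ[ℝ] ℝ :=
    { toFun := fun y => a * y 0 + b * y 1 + c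
      linear := a • LinearMap.proj 0 + b • LinearMap.proj 1
      map_vadd' := fun x v => by simp; ring }
  have hf : ∀ y, f y = a * y 0 + b * y 1 + c := fun y => rfl
  have hmem : ∀ y, y ∈ (AffineSubspace.mk' (0 : ℝ) ⊥).comap f ↔ a * y 0 + b * y 1 + c = 0 := by
    intro y
    simp [AffineSubspace.mem_comap, hf]
  have heq : realLine a b c = ((AffineSubspace.mk' (0 : ℝ) ⊥).comap f : Set (Fin 2 → ℝ)) := by
    ext y
    exact (hmem y).symm
  rw [heq]
  apply Measure.addHaar_affineSubspace
  intro htop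
  have hall : ∀ y : Fin 2 → ℝ, a * y 0 + b * y 1 + c = 0 := fun y =>
    (hmem y).1 (htop ▸ AffineSubspace.mem_top ℝ _ y)
  have h0 := hall ![0, 0]
  have h1 := hall ![1, 0]
  have h2 := hall ![0, 1]
  simp at h0 h1 h2
  subst h0
  simp at h1 h2
  tauto

theorem area_line {ξ : Space F 2 →ᵃ[F] F} (hξ : Regular ξ) : area {x | ξ x = 0} = 0 := by
  obtain ⟨a, b, c, rfl, hab⟩ := exists_eq_functional_of_regular hξ
  have hab' : (a : ℝ) ≠ 0 ∨ (b : ℝ) ≠ 0 := by simpa using hab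
  refine measure_mono_null (closure_minimal ?_ (isClosed_realLine a b c)) (volume_realLine c hab')
  rintro _ ⟨x, hx, rfl⟩
  exact congrArg (Subtype.val : F → ℝ) hx

/-- The filter of complements of sets of area zero. -/
def conull (F : Subfield ℝ) : Filter (Space F 2) where
  sets := {S | area Sᶜ = 0}
  univ_sets := by simp [area_eq]
  sets_of_superset {S T} hS hST := le_antisymm
    ((area_mono (compl_subset_compl.2 hST)).trans (le_of_eq hS)) zero_le
  inter_sets {S T} hS hT := by
    change area (S ∩ T)ᶜ = 0
    rw [compl_inter]
    refine le_antisymm ((area_union_le _ _).trans ?_) zero_le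
    rw [show area Sᶜ = 0 from hS, show area Tᶜ = 0 from hT, zero_add]

theorem conull_le_generic : conull F ≤ generic F := by
  refine le_iInf₂ fun ξ hξ => le_principal_iff.2 ?_
  change area {x | ξ x ≠ 0}ᶜ = 0
  have : {x | ξ x ≠ 0}ᶜ = {x | ξ x = 0} := by
    ext x
    simp
  rw [this, area_line hξ]

theorem area_eq_zero_of_eventually {p : Space F 2 → Prop} (h : ∀ᶠ x in generic F, ¬ p x) :
    area {x | p x} = 0 := by
  have h' : area {x | ¬ p x}ᶜ = 0 := conull_le_generic h
  have : {x | ¬ p x}ᶜ = {x | p x} := by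
    ext x
    simp
  rwa [this] at h'

theorem area_le_of_eventually {S T : Set (Space F 2)} (h : ∀ᶠ x in generic F, x ∈ S → x ∈ T) :
    area S ≤ area T := by
  have h0 : area {x | x ∈ S ∧ x ∉ T} = 0 :=
    area_eq_zero_of_eventually (h.mono fun x hx => by tauto)
  calc area S ≤ area (T ∪ {x | x ∈ S ∧ x ∉ T}) := area_mono fun x hx => by
        by_cases hT : x ∈ T
        exacts [Or.inl hT, Or.inr ⟨hx, hT⟩]
    _ ≤ area T + area {x | x ∈ S ∧ x ∉ T} := area_union_le _ _
    _ = area T := by rw [h0, add_zero]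

/-- Disjointness alone is not enough, as disjoint subsets of F² may be dense in the same region.
Near a real point off the lines of `S`, however, all points of F² have the same signs; if one is in
`S`, all are, so nearby points of `T` lie in `S ∩ T`. -/
theorem Polyhedral.closure_inter_null {S T : Set (Space F 2)} (hS : Polyhedral S)
    (h : ∀ᶠ x in generic F, ¬ (x ∈ S ∧ x ∈ T)) :
    volume (closure (toReal '' S) ∩ closure (toReal '' T)) = 0 := by
  obtain ⟨Ξ, hf, hr, hS⟩ := hS
  have hE : ∀ ξ : Space F 2 →ᵃ[F] F, ∃ f : (Fin 2 → ℝ) → ℝ, Continuous f ∧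
      (∀ x, f (toReal x) = (ξ x : ℝ)) ∧ (ξ ∈ Ξ → volume {y | f y = 0} = 0) := by
    intro ξ
    obtain ⟨a, b, c, rfl⟩ := exists_eq_functional ξ
    refine ⟨fun y => a * y 0 + b * y 1 + c, by fun_prop, fun x => rfl, fun hξ => ?_⟩
    obtain ⟨a', b', c', h, hab⟩ := exists_eq_functional_of_regular (hr _ hξ)
    apply volume_realLine
    by_contra! hab0
    have ha : a = 0 := by simpa using hab0.1
    have hb : b = 0 := by simpa using hab0.2
    subst ha hb
    exact hr _ hξ (by ext x : 1; simp [functional])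
  choose f hfc hfv hf0 using hE
  have hsub : closure (toReal '' S) ∩ closure (toReal '' T) ⊆
      closure (toReal '' {x | x ∈ S ∧ x ∈ T}) ∪ ⋃ ξ ∈ Ξ, {y | f ξ y = 0} := by
    rintro y ⟨hyS, hyT⟩
    by_cases hy : ∃ ξ ∈ Ξ, f ξ y = 0
    · right
      simpa using hy
    left
    push Not at hy
    have hU : ∀ᶠ w in nhds y, ∀ ξ ∈ Ξ, SignType.sign (f ξ w) = SignType.sign (f ξ y) := by
      refine (eventually_all_finite hf).2 fun ξ hξ => ?_
      rcases (hy ξ hξ).lt_or_gt with h0 | h0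
      · filter_upwards [(hfc ξ).continuousAt.eventually_lt continuousAt_const h0] with w hw
        rw [sign_neg hw, sign_neg h0]
      · filter_upwards [continuousAt_const.eventually_lt (hfc ξ).continuousAt h0] with w hw
        rw [sign_pos hw, sign_pos h0]
    have hsign : ∀ (ξ : Space F 2 →ᵃ[F] F) x,
        SignType.sign (f ξ (toReal x)) = SignType.sign (ξ x) := by
      intro ξ x
      rw [hfv]
      rcases lt_trichotomy (ξ x) 0 with h0 | h0 | h0
      · rw [sign_neg h0, sign_neg (show (ξ x : ℝ) < 0 from h0)]
      · simp [h0]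
      · rw [sign_pos h0, sign_pos (show 0 < (ξ x : ℝ) from h0)]
    obtain ⟨_, ⟨x, hxS, rfl⟩, hs⟩ :=
      ((mem_closure_iff_frequently.1 hyS).and_eventually hU).exists
    refine mem_closure_iff_frequently.2
      (((mem_closure_iff_frequently.1 hyT).and_eventually hU).mono ?_)
    rintro _ ⟨⟨x', hx', rfl⟩, hs'⟩
    refine ⟨x', ⟨(hS x x' fun ξ hξ => ?_).1 hxS, hx'⟩, rfl⟩
    rw [← hsign, ← hsign, hs ξ hξ, hs' ξ hξ]
  refine measure_mono_null hsub (measure_union_null (area_eq_zero_of_eventually h) ?_)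
  exact (measure_biUnion_null_iff hf.countable).2 fun ξ hξ => hf0 ξ hξ

/-- Up to finitely many lines, `S` is the disjoint union of the sets `A i`. -/
def AEPartition {ι : Type*} (S : Set (Space F 2)) (A : ι → Set (Space F 2)) : Prop :=
  ∀ᶠ x in generic F, (∀ i j, x ∈ A i → x ∈ A j → i = j) ∧ (x ∈ S ↔ ∃ i, x ∈ A i)

theorem AEPartition.area_eq {ι : Type*} [Fintype ι] {S : Set (Space F 2)}
    {A : ι → Set (Space F 2)} (h : AEPartition S A) (hA : ∀ i, Polyhedral (A i)) :
    area S = ∑ i, area (A i) := by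
  have h1 : area S = area (⋃ i, A i) := le_antisymm
    (area_le_of_eventually (h.mono fun x hx hS => mem_iUnion.2 (hx.2.1 hS)))
    (area_le_of_eventually (h.mono fun x hx hS => hx.2.2 (mem_iUnion.1 hS)))
  rw [h1, RefinedGeometry.area_eq, image_iUnion, closure_iUnion_of_finite, measure_iUnion₀,
    tsum_fintype]
  · rfl
  · intro i j hij
    exact (hA i).closure_inter_null (h.mono fun x hx hxA => hij (hx.1 i j hxA.1 hxA.2))
  · exact fun i => isClosed_closure.measurableSet.nullMeasurableSet

/-! ### Isometries and invariance of area -/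

/-- Polarization shows that g − g 0 preserves dot products. Linearity need not be assumed: g x − g 0
has inner products x₀, x₁ with the images of the basis vectors, which determines it. -/
theorem exists_orthogonal_of_distance_preserving {g : Space F 2 → Space F 2}
    (hg : ∀ x y, (g x - g y) ⬝ᵥ (g x - g y) = (x - y) ⬝ᵥ (x - y)) :
    ∃ u v b : Space F 2, u ⬝ᵥ u = 1 ∧ v ⬝ᵥ v = 1 ∧ u ⬝ᵥ v = 0 ∧
      ∀ x, g x = x 0 • u + x 1 • v + b := by
  have h0 : ∀ x, (g x - g 0) ⬝ᵥ (g x - g 0) = x ⬝ᵥ x := fun x => by simpa using hg x 0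
  have hdot : ∀ x y, (g x - g 0) ⬝ᵥ (g y - g 0) = x ⬝ᵥ y := by
    intro x y
    have h1 := hg x y
    have h2 := h0 x
    have h3 := h0 y
    simp only [dotProduct, Fin.sum_univ_two, Pi.sub_apply] at *
    linear_combination (h2 + h3 - h1) / 2
  refine ⟨g ![1, 0] - g 0, g ![0, 1] - g 0, g 0, by rw [hdot]; simp, by rw [hdot]; simp,
    by rw [hdot]; simp, fun x => ?_⟩
  have huu : (g ![1, 0] - g 0) ⬝ᵥ (g ![1, 0] - g 0) = 1 := by rw [hdot]; simp
  have hvv : (g ![0, 1] - g 0) ⬝ᵥ (g ![0, 1] - g 0) = 1 := by rw [hdot]; simp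
  have huv : (g ![1, 0] - g 0) ⬝ᵥ (g ![0, 1] - g 0) = 0 := by rw [hdot]; simp
  have hxu : (g x - g 0) ⬝ᵥ (g ![1, 0] - g 0) = x 0 := by
    rw [hdot]; simp [Matrix.vecHead]
  have hxv : (g x - g 0) ⬝ᵥ (g ![0, 1] - g 0) = x 1 := by
    rw [hdot]; simp [Matrix.vecHead, Matrix.vecTail]
  have hxx := h0 x
  rw [← sub_eq_iff_eq_add]
  generalize g x - g 0 = w at *
  generalize g ![1, 0] - g 0 = u at *
  generalize g ![0, 1] - g 0 = v at *
  simp only [dotProduct, Fin.sum_univ_two] at huu hvv huv hxu hxv hxx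
  -- The squared norm of the residual w − x₀u − x₁v, expanded by the known inner products, is zero.
  have key : (w 0 - (x 0 * u 0 + x 1 * v 0)) * (w 0 - (x 0 * u 0 + x 1 * v 0)) +
      (w 1 - (x 0 * u 1 + x 1 * v 1)) * (w 1 - (x 0 * u 1 + x 1 * v 1)) = 0 := by
    linear_combination hxx - 2 * x 0 * hxu - 2 * x 1 * hxv + x 0 ^ 2 * huu + x 1 ^ 2 * hvv +
      2 * x 0 * x 1 * huv
  obtain ⟨k0, k1⟩ := (mul_self_add_mul_self_eq_zero).1 key
  funext i
  fin_cases i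
  · simpa using sub_eq_zero.1 k0
  · simpa using sub_eq_zero.1 k1

/-- The isometry extends to a real affine map whose determinant has absolute value 1, and this
extension commutes with closure. -/
theorem Congruent.area_eq {P Q : Set (Space F 2)} (h : Congruent P Q) : area P = area Q := by
  obtain ⟨g, hg, rfl⟩ := h
  obtain ⟨u, v, b, huu, hvv, huv, hgx⟩ := exists_orthogonal_of_distance_preserving hg
  let M : Matrix (Fin 2) (Fin 2) ℝ := !![(u 0 : ℝ), (v 0 : ℝ); (u 1 : ℝ), (v 1 : ℝ)]
  have hdet : |LinearMap.det (Matrix.toLin' M)| = 1 := by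
    rw [LinearMap.det_toLin', Matrix.det_fin_two]
    simp only [dotProduct, Fin.sum_univ_two] at huu hvv huv
    have h1 : (u 0 * v 1 - v 0 * u 1) ^ 2 = 1 := by
      linear_combination (v 0 * v 0 + v 1 * v 1) * huu + hvv - (u 0 * v 0 + u 1 * v 1) * huv
    have h2 : ((u 0 : ℝ) * v 1 - v 0 * u 1) ^ 2 = 1 := by exact_mod_cast h1
    have h3 := (sq_eq_sq_iff_abs_eq_abs ((u 0 : ℝ) * v 1 - v 0 * u 1) 1).1 (by rw [h2, one_pow])
    simpa [M] using h3
  have hdet0 : LinearMap.det (Matrix.toLin' M) ≠ 0 := by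
    intro h
    rw [h] at hdet
    simp at hdet
  let L : (Fin 2 → ℝ) ≃L[ℝ] (Fin 2 → ℝ) :=
    (LinearMap.equivOfDetNeZero (Matrix.toLin' M) hdet0).toContinuousLinearEquiv
  have hL : ∀ y, L y = Matrix.toLin' M y := fun y => rfl
  have himage : toReal '' (g '' P) = (fun y => y + toReal b) '' (L '' (toReal '' P)) := by
    simp only [image_image]
    refine image_congr fun x _ => ?_
    rw [hgx, hL]
    funext i
    fin_cases i <;> simp [toReal, M, dotProduct, Fin.sum_univ_two] <;> ring
  have hcl : closure ((fun y => y + toReal b) '' (L '' (toReal '' P))) =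
      (fun y => y + toReal b) '' (L '' closure (toReal '' P)) := by
    rw [L.image_closure]
    exact ((Homeomorph.addRight (toReal b)).image_closure _).symm
  have hlin : L '' closure (toReal '' P) = Matrix.toLin' M '' closure (toReal '' P) := rfl
  rw [RefinedGeometry.area_eq, RefinedGeometry.area_eq, himage, hcl, image_add_right,
    measure_preimage_add_right, hlin, Measure.addHaar_image_linearMap, hdet]
  simp

/-- The rectangle `[0, 1) × [0, d)`. -/
def rectangle (d : F) : Set (Space F 2) := {x | 0 ≤ x 0 ∧ x 0 < 1 ∧ 0 ≤ x 1 ∧ x 1 < d}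

theorem closure_image_coe_Ico {d : F} (hd : 0 < d) :
    closure ((fun x : F => (x : ℝ)) '' Ico 0 d) = Icc 0 (d : ℝ) := by
  apply Subset.antisymm
  · refine closure_minimal ?_ isClosed_Icc
    rintro _ ⟨x, hx, rfl⟩
    exact ⟨hx.1, le_of_lt hx.2⟩
  · have hd' : (0 : ℝ) ≠ d := fun h => hd.ne (Subtype.ext h)
    have hdense : Dense (range fun x : F => (x : ℝ)) := by
      refine Dense.mono ?_ (Rat.denseRange_cast (𝕜 := ℝ))
      rintro _ ⟨q, rfl⟩
      exact ⟨(q : F), by simp⟩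
    rw [← closure_Ioo hd']
    refine closure_minimal ?_ isClosed_closure
    refine (hdense.open_subset_closure_inter isOpen_Ioo).trans (closure_mono ?_)
    rintro _ ⟨hx, x, rfl⟩
    exact ⟨x, ⟨le_of_lt hx.1, hx.2⟩, rfl⟩

theorem area_rectangle {d : F} (hd : 0 ≤ d) : area (rectangle d) = ENNReal.ofReal d := by
  rcases hd.eq_or_lt with rfl | hd
  · have : rectangle (0 : F) = ∅ := by
      ext x
      simp only [rectangle, mem_ofPred_eq, mem_empty_iff_false, iff_false]
      rintro ⟨-, -, h1, h2⟩
      exact absurd h1 (not_le.2 h2)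
    simp [this, area_eq]
  · have himage : toReal '' rectangle d =
        univ.pi fun i => (fun x : F => (x : ℝ)) '' Ico 0 ((![1, d] : Space F 2) i) := by
      ext y
      simp only [mem_univ_pi, Fin.forall_fin_two, mem_image]
      constructor
      · rintro ⟨x, ⟨h0, h1, h2, h3⟩, rfl⟩
        exact ⟨⟨x 0, ⟨h0, h1⟩, rfl⟩, ⟨x 1, ⟨h2, h3⟩, rfl⟩⟩
      · rintro ⟨⟨a, ⟨h0, h1⟩, h⟩, ⟨b, ⟨h2, h3⟩, h'⟩⟩
        refine ⟨![a, b], ⟨h0, h1, h2, h3⟩, ?_⟩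
        funext i
        fin_cases i
        exacts [h, h']
    have hpos : ∀ i, 0 < (![1, d] : Space F 2) i := by
      intro i
      fin_cases i
      exacts [one_pos, hd]
    rw [area_eq, himage, closure_pi_set]
    simp only [closure_image_coe_Ico (hpos _)]
    rw [pi_univ_Icc (fun _ => (0 : ℝ)) fun i => (((![1, d] : Space F 2) i : F) : ℝ),
      Real.volume_Icc_pi]
    simp [Fin.prod_univ_two]

/-! ### Affine bijections in coordinates -/

theorem mem_image_affineEquiv {φ : Space F 2 ≃ᵃ[F] Space F 2} {S : Set (Space F 2)}
    {x : Space F 2} : x ∈ φ '' S ↔ φ.symm x ∈ S := by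
  constructor
  · rintro ⟨y, hy, rfl⟩
    rwa [φ.symm_apply_apply]
  · exact fun h => ⟨_, h, φ.apply_symm_apply x⟩

/-- The affine bijection `x ↦ (a x₀ + b x₁ + s, c x₀ + d x₁ + t)`. -/
def affine (a b c d s t : F) (h : a * d - b * c ≠ 0) : Space F 2 ≃ᵃ[F] Space F 2 where
  toFun x := ![a * x 0 + b * x 1 + s, c * x 0 + d * x 1 + t]
  invFun x := ![(d * (x 0 - s) - b * (x 1 - t)) / (a * d - b * c),
    (a * (x 1 - t) - c * (x 0 - s)) / (a * d - b * c)]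
  left_inv x := by
    funext i
    fin_cases i
    · exact (div_eq_iff h).2 (by simp; ring)
    · exact (div_eq_iff h).2 (by simp; ring)
  right_inv x := by
    funext i
    fin_cases i
    · refine (mul_right_cancel₀ h ?_)
      simp only [Fin.zero_eta, Matrix.cons_val_zero, Matrix.cons_val_one, add_mul, mul_assoc,
        div_mul_cancel₀ _ h]
      ring
    · refine (mul_right_cancel₀ h ?_)
      simp only [Fin.mk_one, Matrix.cons_val_zero, Matrix.cons_val_one, add_mul, mul_assoc,
        div_mul_cancel₀ _ h]
      ring
  linear :=
    { toFun := fun x => ![a * x 0 + b * x 1, c * x 0 + d * x 1]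
      invFun := fun x => ![(d * x 0 - b * x 1) / (a * d - b * c),
        (a * x 1 - c * x 0) / (a * d - b * c)]
      left_inv := fun x => by
        funext i
        fin_cases i
        · exact (div_eq_iff h).2 (by simp; ring)
        · exact (div_eq_iff h).2 (by simp; ring)
      right_inv := fun x => by
        funext i
        fin_cases i
        · refine (mul_right_cancel₀ h ?_)
          simp only [Fin.zero_eta, Matrix.cons_val_zero, Matrix.cons_val_one, add_mul, mul_assoc,
            div_mul_cancel₀ _ h]
          ring
        · refine (mul_right_cancel₀ h ?_)
          simp only [Fin.mk_one, Matrix.cons_val_zero, Matrix.cons_val_one, add_mul, mul_assoc,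
            div_mul_cancel₀ _ h]
          ring
      map_add' := fun x y => by
        funext i
        fin_cases i <;> simp <;> ring
      map_smul' := fun r x => by
        funext i
        fin_cases i <;> simp <;> ring }
  map_vadd' x v := by
    funext i
    fin_cases i <;> simp <;> ring

section

variable {a b c d s t : F} {h : a * d - b * c ≠ 0} (x : Space F 2)

theorem affine_apply :
    affine a b c d s t h x = ![a * x 0 + b * x 1 + s, c * x 0 + d * x 1 + t] := rfl

@[simp]
theorem affine_apply_zero : affine a b c d s t h x 0 = a * x 0 + b * x 1 + s := rfl

@[simp]
theorem affine_apply_one : affine a b c d s t h x 1 = c * x 0 + d * x 1 + t := rfl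

@[simp]
theorem affine_symm_apply_zero : (affine a b c d s t h).symm x 0 =
    (d * (x 0 - s) - b * (x 1 - t)) / (a * d - b * c) := rfl

@[simp]
theorem affine_symm_apply_one : (affine a b c d s t h).symm x 1 =
    (a * (x 1 - t) - c * (x 0 - s)) / (a * d - b * c) := rfl

end

theorem affineEquiv_ext {φ ψ : Space F 2 ≃ᵃ[F] Space F 2} (h0 : ∀ x, φ x 0 = ψ x 0)
    (h1 : ∀ x, φ x 1 = ψ x 1) : φ = ψ := by
  refine AffineEquiv.ext fun x => ?_
  funext i
  fin_cases i
  exacts [h0 x, h1 x]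

theorem exists_apply_eq (φ : Space F 2 ≃ᵃ[F] Space F 2) (i : Fin 2) :
    ∃ a b c : F, ∀ x, φ x i = a * x 0 + b * x 1 + c := by
  obtain ⟨a, b, c, h⟩ := exists_eq_functional
    ((LinearMap.proj (R := F) (φ := fun _ : Fin 2 => F) i).toAffineMap.comp φ.toAffineMap)
  exact ⟨a, b, c, fun x => congrArg (fun ξ : Space F 2 →ᵃ[F] F => ξ x) h⟩

theorem exists_eq_affine (φ : Space F 2 ≃ᵃ[F] Space F 2) :
    ∃ (a b c d s t : F) (h : a * d - b * c ≠ 0), φ = affine a b c d s t h := by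
  obtain ⟨a, b, s, h0⟩ := exists_apply_eq φ 0
  obtain ⟨c, d, t, h1⟩ := exists_apply_eq φ 1
  have hinj : ∀ x y : F, a * x + b * y = 0 → c * x + d * y = 0 → x = 0 ∧ y = 0 := by
    intro x y hx hy
    have : φ ![x, y] = φ 0 := by
      funext i
      fin_cases i
      · simp [h0, hx]
      · simp [h1, hy]
    have := φ.injective this
    exact ⟨congrFun this 0, congrFun this 1⟩
  have h : a * d - b * c ≠ 0 := by
    intro hdet
    obtain ⟨hb, ha⟩ := hinj b (-a) (by ring) (by linear_combination -hdet)
    rw [neg_eq_zero] at ha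
    obtain ⟨hd, hc⟩ := hinj d (-c) (by linear_combination hdet) (by ring)
    rw [neg_eq_zero] at hc
    exact one_ne_zero (hinj 1 0 (by rw [ha]; ring) (by rw [hc]; ring)).1
  exact ⟨a, b, c, d, s, t, h, affineEquiv_ext h0 h1⟩

/-! ### Bounded sets -/

/-- The coordinates are bounded on `S`. -/
def CoordBounded (S : Set (Space F 2)) : Prop := ∃ R : F, ∀ x ∈ S, ∀ i, |x i| ≤ R

theorem CoordBounded.mono {S T : Set (Space F 2)} (h : CoordBounded T) (hST : S ⊆ T) :
    CoordBounded S :=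
  h.imp fun _ hR x hx => hR x (hST hx)

theorem CoordBounded.image {S : Set (Space F 2)} (h : CoordBounded S)
    (φ : Space F 2 ≃ᵃ[F] Space F 2) : CoordBounded (φ '' S) := by
  obtain ⟨R, hR⟩ := h
  have key : ∀ i, ∃ R', ∀ x ∈ S, |φ x i| ≤ R' := by
    intro i
    obtain ⟨a, b, c, h⟩ := exists_apply_eq φ i
    refine ⟨|a| * R + |b| * R + |c|, fun x hx => ?_⟩
    rw [h]
    refine (abs_add_le _ _).trans (add_le_add ((abs_add_le _ _).trans ?_) le_rfl)
    rw [abs_mul, abs_mul]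
    exact add_le_add (mul_le_mul_of_nonneg_left (hR x hx 0) (abs_nonneg _))
      (mul_le_mul_of_nonneg_left (hR x hx 1) (abs_nonneg _))
  choose R' hR' using key
  refine ⟨max (R' 0) (R' 1), ?_⟩
  rintro _ ⟨x, hx, rfl⟩ i
  refine (hR' i x hx).trans ?_
  fin_cases i
  exacts [le_max_left _ _, le_max_right _ _]

theorem coordBounded_of_isBounded {S : Set (Space F 2)} (h : Bornology.IsBounded S) :
    CoordBounded S := by
  obtain ⟨C, hC⟩ := isBounded_iff_forall_norm_le.1 h
  obtain ⟨n, hn⟩ := exists_nat_ge C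
  refine ⟨n, fun x hx i => ?_⟩
  have h1 : ‖x i‖ ≤ n := ((norm_le_pi_norm x i).trans (hC x hx)).trans hn
  have h2 : |((x i : F) : ℝ)| ≤ n := h1
  rw [abs_le] at h2 ⊢
  exact ⟨by exact_mod_cast h2.1, by exact_mod_cast h2.2⟩

theorem CoordBounded.isBounded {S : Set (Space F 2)} (h : CoordBounded S) :
    Bornology.IsBounded S := by
  obtain ⟨R, hR⟩ := h
  refine isBounded_iff_forall_norm_le.2 ⟨max R 0, fun x hx => ?_⟩
  refine (pi_norm_le_iff_of_nonneg (le_max_right _ _)).2 fun i => le_max_of_le_left ?_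
  have h1 := abs_le.1 (hR x hx i)
  have h2 : |((x i : F) : ℝ)| ≤ R := abs_le.2 ⟨by exact_mod_cast h1.1, by exact_mod_cast h1.2⟩
  exact h2

theorem IsPolygon.coordBounded {P : Set (Space F 2)} (h : IsPolygon P) : CoordBounded P := by
  obtain ⟨𝒞, hf, hC, rfl⟩ := h
  exact coordBounded_of_isBounded ((Bornology.isBounded_sUnion hf).2 fun C h => (hC C h).1.1)

/-! ### Partitions -/

section

variable {ι κ : Type*} {S T : Set (Space F 2)} {A : ι → Set (Space F 2)}

theorem AEPartition.congr_left (h : AEPartition S A) (hST : S =ᶠ[generic F] T) :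
    AEPartition T A := by
  filter_upwards [h, hST.mem_iff] with x hx hx'
  exact ⟨hx.1, hx'.symm.trans hx.2⟩

theorem AEPartition.image (h : AEPartition S A) (φ : Space F 2 ≃ᵃ[F] Space F 2) :
    AEPartition (φ '' S) fun i => φ '' A i := by
  filter_upwards [(tendsto_generic φ.symm).eventually h] with x hx
  simpa only [mem_image_affineEquiv] using hx

theorem AEPartition.reindex (h : AEPartition S A) (e : κ ≃ ι) :
    AEPartition S fun k => A (e k) := by
  filter_upwards [h] with x hx
  exact ⟨fun i j hi hj => e.injective (hx.1 _ _ hi hj),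
    hx.2.trans (e.exists_congr fun _ => Iff.rfl).symm⟩

theorem AEPartition.sigma [Finite ι] {κ : ι → Type*} {B : ∀ i, κ i → Set (Space F 2)}
    (h : AEPartition S A) (hB : ∀ i, AEPartition (A i) (B i)) :
    AEPartition S fun p : Σ i, κ i => B p.1 p.2 := by
  filter_upwards [h, eventually_all.2 hB] with x hx hxB
  constructor
  · rintro ⟨i, k⟩ ⟨j, l⟩ hi hj
    obtain rfl := hx.1 i j ((hxB i).2.2 ⟨k, hi⟩) ((hxB j).2.2 ⟨l, hj⟩)
    obtain rfl := (hxB i).1 k l hi hj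
    rfl
  · rw [hx.2, Sigma.exists]
    exact exists_congr fun i => (hxB i).2

/-- The common refinement of two partitions of `T`, pulled back to `S` along the pieces; it makes
scissors congruence transitive. -/
theorem AEPartition.inter_preimage [Finite ι] {B : κ → Set (Space F 2)}
    {g : ι → Space F 2 ≃ᵃ[F] Space F 2} (hS : AEPartition S A)
    (hT : AEPartition T fun i => g i '' A i) (hB : AEPartition T B) :
    AEPartition S fun p : ι × κ => A p.1 ∩ g p.1 ⁻¹' B p.2 := by
  filter_upwards [hS, eventually_all.2 fun i => (tendsto_generic (g i)).eventually hT,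
    eventually_all.2 fun i => (tendsto_generic (g i)).eventually hB] with x hx hxT hxB
  constructor
  · rintro ⟨i, k⟩ ⟨j, l⟩ ⟨hi, hk⟩ ⟨hj, hl⟩
    obtain rfl := hx.1 i j hi hj
    obtain rfl := (hxB i).1 k l hk hl
    rfl
  · rw [hx.2]
    constructor
    · rintro ⟨i, hi⟩
      obtain ⟨k, hk⟩ := (hxB i).2.1 ((hxT i).2.2 ⟨i, mem_image_of_mem _ hi⟩)
      exact ⟨(i, k), hi, hk⟩
    · rintro ⟨⟨i, k⟩, hi, -⟩
      exact ⟨i, hi⟩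

end

/-! ### Scissors congruence by translations and point reflections -/

/-- Translations and point reflections. -/
def IsTranslationOrReflection (g : Space F 2 ≃ᵃ[F] Space F 2) : Prop :=
  ∃ ε : F, (ε = 1 ∨ ε = -1) ∧ ∀ x y, g x - g y = ε • (x - y)

namespace IsTranslationOrReflection

variable {g h : Space F 2 ≃ᵃ[F] Space F 2}

theorem refl : IsTranslationOrReflection (AffineEquiv.refl F (Space F 2)) :=
  ⟨1, Or.inl rfl, by simp⟩

theorem trans (hg : IsTranslationOrReflection g) (hh : IsTranslationOrReflection h) :
    IsTranslationOrReflection (g.trans h) := by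
  obtain ⟨ε, hε, hg⟩ := hg
  obtain ⟨δ, hδ, hh⟩ := hh
  refine ⟨δ * ε, ?_, fun x y => ?_⟩
  · rcases hε with rfl | rfl <;> rcases hδ with rfl | rfl <;> simp
  · rw [AffineEquiv.trans_apply, AffineEquiv.trans_apply, hh, hg, smul_smul]

theorem symm (hg : IsTranslationOrReflection g) : IsTranslationOrReflection g.symm := by
  obtain ⟨ε, hε, hg⟩ := hg
  refine ⟨ε, hε, fun x y => ?_⟩
  have h := hg (g.symm x) (g.symm y)
  rw [g.apply_symm_apply, g.apply_symm_apply] at h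
  have hεε : ε * ε = 1 := by rcases hε with rfl | rfl <;> simp
  rw [h, smul_smul, hεε, one_smul]

/-- Multiplication by ±1 commutes with every linear map. This is why general isometries are avoided:
scissors congruence becomes invariant under all affine bijections. -/
theorem conj (hg : IsTranslationOrReflection g) (φ : Space F 2 ≃ᵃ[F] Space F 2) :
    IsTranslationOrReflection (φ.symm.trans (g.trans φ)) := by
  obtain ⟨ε, hε, hg⟩ := hg
  refine ⟨ε, hε, fun x y => ?_⟩
  have hsub : ∀ (ψ : Space F 2 ≃ᵃ[F] Space F 2) (x y : Space F 2),
      ψ x - ψ y = ψ.linear (x - y) := fun ψ x y =>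
    (ψ.toAffineMap.linearMap_vsub x y).symm
  have h1 := hsub φ (φ.symm x) (φ.symm y)
  rw [φ.apply_symm_apply, φ.apply_symm_apply] at h1
  simp only [AffineEquiv.trans_apply]
  rw [hsub φ, hg, map_smul, ← h1]

theorem dotProduct_eq (hg : IsTranslationOrReflection g) (x y : Space F 2) :
    (g x - g y) ⬝ᵥ (g x - g y) = (x - y) ⬝ᵥ (x - y) := by
  obtain ⟨ε, hε, hg⟩ := hg
  rw [hg, smul_dotProduct, dotProduct_smul]
  rcases hε with rfl | rfl <;> simp

theorem congruent (hg : IsTranslationOrReflection g) (S : Set (Space F 2)) :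
    Congruent S (g '' S) :=
  ⟨g.toEquiv, hg.dotProduct_eq, rfl⟩

end IsTranslationOrReflection

/-- Up to finitely many lines, `S` and `T` can be partitioned into bounded polyhedral sets that
correspond under translations and point reflections. -/
def ScissorsCongruent (S T : Set (Space F 2)) : Prop :=
  ∃ (ι : Type) (_ : Fintype ι) (A : ι → Set (Space F 2)) (g : ι → Space F 2 ≃ᵃ[F] Space F 2),
    (∀ i, Polyhedral (A i) ∧ CoordBounded (A i)) ∧ (∀ i, IsTranslationOrReflection (g i)) ∧
    AEPartition S A ∧ AEPartition T fun i => g i '' A i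

namespace ScissorsCongruent

variable {S T U S' T' : Set (Space F 2)}

theorem of_image {g : Space F 2 ≃ᵃ[F] Space F 2} (hg : IsTranslationOrReflection g)
    (hS : Polyhedral S) (hb : CoordBounded S) : ScissorsCongruent S (g '' S) :=
  ⟨Unit, inferInstance, fun _ => S, fun _ => g, fun _ => ⟨hS, hb⟩, fun _ => hg,
    Eventually.of_forall fun x => by simp, Eventually.of_forall fun x => by simp⟩

theorem symm (h : ScissorsCongruent S T) : ScissorsCongruent T S := by
  obtain ⟨ι, _, A, g, hA, hg, hS, hT⟩ := h
  refine ⟨ι, inferInstance, fun i => g i '' A i, fun i => (g i).symm,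
    fun i => ⟨(hA i).1.image _, (hA i).2.image _⟩, fun i => (hg i).symm, hT, ?_⟩
  simpa only [image_image, AffineEquiv.symm_apply_apply, image_id'] using hS

theorem trans (h : ScissorsCongruent S T) (h' : ScissorsCongruent T U) :
    ScissorsCongruent S U := by
  obtain ⟨ι, _, A, g, hA, hg, hS, hT⟩ := h
  obtain ⟨κ, _, B, f, hB, hf, hT', hU⟩ := h'
  refine ⟨ι × κ, inferInstance, fun p => A p.1 ∩ g p.1 ⁻¹' B p.2, fun p => (g p.1).trans (f p.2),
    fun p => ⟨(hA p.1).1.inter ((hB p.2).1.preimage _), (hA p.1).2.mono inter_subset_left⟩,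
    fun p => (hg p.1).trans (hf p.2), hS.inter_preimage hT hT', ?_⟩
  have hT'' : AEPartition T fun k => (f k).symm '' (f k '' B k) := by
    simpa only [image_image, AffineEquiv.symm_apply_apply, image_id'] using hT'
  -- Run the same refinement backwards from `U`, then match its pieces with the images of the pieces
  -- of `S`.
  have h := (hU.inter_preimage hT'' hT).reindex (Equiv.prodComm ι κ)
  filter_upwards [h] with x hx
  have key : ∀ p : ι × κ, x ∈ (fun y => ((g p.1).trans (f p.2)) y) '' (A p.1 ∩ g p.1 ⁻¹' B p.2) ↔
      x ∈ f p.2 '' B p.2 ∩ (f p.2).symm ⁻¹' (g p.1 '' A p.1) := by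
    intro p
    change x ∈ ((g p.1).trans (f p.2)) '' (A p.1 ∩ g p.1 ⁻¹' B p.2) ↔ _
    simp only [mem_image_affineEquiv, mem_inter_iff, mem_preimage]
    change (g p.1).symm ((f p.2).symm x) ∈ A p.1 ∧
      g p.1 ((g p.1).symm ((f p.2).symm x)) ∈ B p.2 ↔ _
    rw [AffineEquiv.apply_symm_apply, and_comm]
  refine ⟨fun p q hp hq => hx.1 p q ((key p).1 hp) ((key q).1 hq), hx.2.trans ?_⟩
  exact exists_congr fun p => (key p).symm

theorem congr (h : ScissorsCongruent S T) (hS : S =ᶠ[generic F] S') (hT : T =ᶠ[generic F] T') :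
    ScissorsCongruent S' T' := by
  obtain ⟨ι, _, A, g, hA, hg, h1, h2⟩ := h
  exact ⟨ι, inferInstance, A, g, hA, hg, h1.congr_left hS, h2.congr_left hT⟩

theorem image (h : ScissorsCongruent S T) (φ : Space F 2 ≃ᵃ[F] Space F 2) :
    ScissorsCongruent (φ '' S) (φ '' T) := by
  obtain ⟨ι, _, A, g, hA, hg, h1, h2⟩ := h
  refine ⟨ι, inferInstance, fun i => φ '' A i, fun i => φ.symm.trans ((g i).trans φ),
    fun i => ⟨(hA i).1.image _, (hA i).2.image _⟩, fun i => (hg i).conj φ, h1.image φ, ?_⟩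
  have := h2.image φ
  simpa only [image_image, AffineEquiv.trans_apply, AffineEquiv.symm_apply_apply] using this

theorem union (h : ScissorsCongruent S T) (h' : ScissorsCongruent S' T')
    (hS : ∀ᶠ x in generic F, ¬(x ∈ S ∧ x ∈ S')) (hT : ∀ᶠ x in generic F, ¬(x ∈ T ∧ x ∈ T')) :
    ScissorsCongruent (S ∪ S') (T ∪ T') := by
  obtain ⟨ι, _, A, g, hA, hg, h1, h2⟩ := h
  obtain ⟨κ, _, B, f, hB, hf, h1', h2'⟩ := h'
  have key : ∀ {S S' : Set (Space F 2)} {A : ι → Set (Space F 2)} {B : κ → Set (Space F 2)},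
      AEPartition S A → AEPartition S' B → (∀ᶠ x in generic F, ¬(x ∈ S ∧ x ∈ S')) →
      AEPartition (S ∪ S') (Sum.elim A B) := by
    intro S S' A B hA hB hd
    filter_upwards [hA, hB, hd] with x hxA hxB hxd
    constructor
    · rintro (i | i) (j | j) hi hj
      · rw [hxA.1 i j hi hj]
      · exact absurd ⟨hxA.2.2 ⟨i, hi⟩, hxB.2.2 ⟨j, hj⟩⟩ hxd
      · exact absurd ⟨hxA.2.2 ⟨j, hj⟩, hxB.2.2 ⟨i, hi⟩⟩ hxd
      · rw [hxB.1 i j hi hj]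
    · rw [mem_union, hxA.2, hxB.2, Sum.exists]
      rfl
  refine ⟨ι ⊕ κ, inferInstance, Sum.elim A B, Sum.elim g f, ?_, ?_, key h1 h1' hS, ?_⟩
  · rintro (i | i)
    exacts [hA i, hB i]
  · rintro (i | i)
    exacts [hg i, hf i]
  · have := key h2 h2' hT
    convert this using 1
    funext i
    rcases i with i | i <;> rfl

theorem area_eq (h : ScissorsCongruent S T) : area S = area T := by
  obtain ⟨ι, _, A, g, hA, hg, h1, h2⟩ := h
  rw [h1.area_eq fun i => (hA i).1, h2.area_eq fun i => (hA i).1.image _]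
  exact Finset.sum_congr rfl fun i _ => ((hg i).congruent _).area_eq

end ScissorsCongruent

/-! ### Parallelograms and rectangles -/

theorem polyhedral_nonneg (a b c : F) (h : a ≠ 0 ∨ b ≠ 0) :
    Polyhedral {x : Space F 2 | 0 ≤ a * x 0 + b * x 1 + c} :=
  polyhedral_closedHalfSpace (regular_functional c h)

theorem polyhedral_neg (a b c : F) (h : a ≠ 0 ∨ b ≠ 0) :
    Polyhedral {x : Space F 2 | a * x 0 + b * x 1 + c < 0} := by
  convert (polyhedral_nonneg a b c h).compl using 1
  ext x
  simp

theorem eventually_ne (a b c : F) (h : a ≠ 0 ∨ b ≠ 0) :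
    ∀ᶠ x in generic F, a * x 0 + b * x 1 + c ≠ 0 :=
  (regular_functional c h).eventually_ne

theorem polyhedral_rectangle (d : F) : Polyhedral (rectangle d) := by
  convert (polyhedral_nonneg 1 0 0 (Or.inl one_ne_zero)).inter
    ((polyhedral_neg 1 0 (-1) (Or.inl one_ne_zero)).inter
    ((polyhedral_nonneg 0 1 0 (Or.inr one_ne_zero)).inter
    (polyhedral_neg 0 1 (-d) (Or.inr one_ne_zero)))) using 1
  ext x
  simp [rectangle]

theorem coordBounded_rectangle (d : F) : CoordBounded (rectangle d) := by
  refine ⟨max 1 d, ?_⟩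
  rintro x ⟨h0, h1, h2, h3⟩ i
  fin_cases i
  · exact (abs_of_nonneg h0).trans_le (h1.le.trans (le_max_left _ _))
  · exact (abs_of_nonneg h2).trans_le (h3.le.trans (le_max_right _ _))

/-- The translation by `(s, t)`. -/
def translation (s t : F) : Space F 2 ≃ᵃ[F] Space F 2 := affine 1 0 0 1 s t (by simp)

theorem isTranslationOrReflection_translation (s t : F) :
    IsTranslationOrReflection (translation s t) := by
  refine ⟨1, Or.inl rfl, fun x y => ?_⟩
  funext i
  fin_cases i <;> simp [translation, affine_apply]

/-- The shear `x ↦ (x₀ + k x₁, x₁)`. -/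
def shear (k : F) : Space F 2 ≃ᵃ[F] Space F 2 := affine 1 k 0 1 0 0 (by simp)

theorem exists_int_le_lt (x : F) : ∃ n : ℤ, (n : F) ≤ x ∧ x < n + 1 := by
  refine ⟨⌊(x : ℝ)⌋, ?_, ?_⟩
  · have := Int.floor_le (x : ℝ)
    exact_mod_cast this
  · have := Int.lt_floor_add_one (x : ℝ)
    exact_mod_cast this

/-- Cut the sheared square into the strips n ≤ x₀ < n + 1 and translate each by −n. Every horizontal
section is an interval [kx₁, kx₁ + 1), which reduction mod 1 maps bijectively onto [0,1). -/
theorem scissorsCongruent_shear (k : F) :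
    ScissorsCongruent (rectangle (1 : F)) (shear k '' rectangle 1) := by
  apply ScissorsCongruent.symm
  obtain ⟨N, hN⟩ := exists_nat_ge |k|
  have hk := abs_le.1 hN
  let A : ℤ → Set (Space F 2) := fun n =>
    shear k '' rectangle 1 ∩ {x | (n : F) ≤ x 0 ∧ x 0 < n + 1}
  have hmem : ∀ n x, x ∈ A n ↔ (0 ≤ x 0 - k * x 1 ∧ x 0 - k * x 1 < 1 ∧ 0 ≤ x 1 ∧ x 1 < 1) ∧
      (n : F) ≤ x 0 ∧ x 0 < n + 1 := by
    intro n x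
    simp only [A, mem_inter_iff, mem_image_affineEquiv]
    simp [rectangle, shear]
  have hmem' : ∀ (n : ℤ) x, x ∈ translation (-(n : F)) 0 '' A n ↔
      (0 ≤ x 0 + n - k * x 1 ∧ x 0 + n - k * x 1 < 1 ∧ 0 ≤ x 1 ∧ x 1 < 1) ∧
        (n : F) ≤ x 0 + n ∧ x 0 + n < n + 1 := by
    intro n x
    rw [mem_image_affineEquiv, hmem]
    simp [translation]
  have huniq : ∀ {m n : ℤ} {y : F}, (m : F) ≤ y → y < m + 1 → (n : F) ≤ y → y < n + 1 →
      m = n := by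
    intro m n y h1 h2 h3 h4
    have h5 : (m : F) < n + 1 := h1.trans_lt h4
    have h6 : (n : F) < m + 1 := h3.trans_lt h2
    have h5' : m < n + 1 := by exact_mod_cast h5
    have h6' : n < m + 1 := by exact_mod_cast h6
    omega
  have hkx : ∀ y : F, 0 ≤ y → y < 1 → -(N : F) ≤ k * y ∧ k * y ≤ N := by
    intro y h0 h1
    have hN0 : (0 : F) ≤ N := Nat.cast_nonneg N
    constructor <;> nlinarith
  have hrange : ∀ (n : ℤ) (x : Space F 2), 0 ≤ x 1 → x 1 < 1 → (n : F) < k * x 1 + 1 →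
      k * x 1 - 1 < n → n ∈ Finset.Icc (-(N : ℤ) - 1) (N + 1) := by
    intro n x h0 h1 h2 h3
    have := hkx _ h0 h1
    have h4 : ((-(N : ℤ) - 1 : ℤ) : F) ≤ n := by push_cast; linarith
    have h5 : (n : F) ≤ ((N + 1 : ℤ) : F) := by push_cast; linarith
    exact Finset.mem_Icc.2 ⟨by exact_mod_cast h4, by exact_mod_cast h5⟩
  -- Since |k x₁| ≤ N, only these strips can meet the sheared square.
  refine ⟨Finset.Icc (-(N : ℤ) - 1) (N + 1), inferInstance, fun n => A n,
    fun n => translation (-(n : F)) 0, fun n => ⟨?_, ?_⟩,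
    fun n => isTranslationOrReflection_translation _ _, ?_, ?_⟩
  · refine ((polyhedral_rectangle 1).image _).inter ?_
    convert (polyhedral_nonneg 1 0 (-(n : F)) (Or.inl one_ne_zero)).inter
      (polyhedral_neg 1 0 (-(n : F) - 1) (Or.inl one_ne_zero)) using 1
    ext x
    simp only [mem_ofPred_eq, mem_inter_iff]
    constructor <;> rintro ⟨h1, h2⟩ <;> constructor <;> linarith
  · exact ((coordBounded_rectangle 1).image _).mono inter_subset_left
  · refine Eventually.of_forall fun x => ⟨fun m n hm hn => ?_, ?_⟩
    · rw [hmem] at hm hn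
      exact Subtype.ext (huniq hm.2.1 hm.2.2 hn.2.1 hn.2.2)
    · constructor
      · intro hx
        have hx' : 0 ≤ x 0 - k * x 1 ∧ x 0 - k * x 1 < 1 ∧ 0 ≤ x 1 ∧ x 1 < 1 := by
          rw [mem_image_affineEquiv] at hx
          simpa [rectangle, shear] using hx
        obtain ⟨n, hn⟩ := exists_int_le_lt (x 0)
        exact ⟨⟨n, hrange n x hx'.2.2.1 hx'.2.2.2 (by linarith) (by linarith)⟩, hx, hn⟩
      · rintro ⟨n, hn⟩
        exact hn.1
  · refine Eventually.of_forall fun x => ⟨fun m n hm hn => ?_, ?_⟩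
    · rw [hmem'] at hm hn
      have := huniq (m := -m) (n := -n) (y := x 0 - k * x 1) (by push_cast; linarith)
        (by push_cast; linarith) (by push_cast; linarith) (by push_cast; linarith)
      exact Subtype.ext (neg_injective this)
    · simp only [hmem']
      constructor
      · rintro ⟨h0, h1, h2, h3⟩
        obtain ⟨n, hn⟩ := exists_int_le_lt (x 0 - k * x 1)
        refine ⟨⟨-n, hrange _ x h2 h3 ?_ ?_⟩, ⟨?_, ?_, h2, h3⟩, ?_, ?_⟩ <;> push_cast <;> linarith
      · rintro ⟨n, ⟨h0, h1, h2, h3⟩, h4, h5⟩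
        exact ⟨by linarith, by linarith, h2, h3⟩

/-- Scissors congruence of the images of the unit square under two affine maps. -/
theorem ScissorsCongruent.image_trans {φ ψ : Space F 2 ≃ᵃ[F] Space F 2} {T : Set (Space F 2)}
    (h : ScissorsCongruent (rectangle (1 : F)) (ψ '' rectangle 1))
    (h' : ScissorsCongruent ((ψ.trans φ) '' rectangle 1) T) :
    ScissorsCongruent (φ '' rectangle 1) T := by
  refine ScissorsCongruent.trans ?_ h'
  have := h.image φ
  rwa [image_image] at this

/-- The reflection that exchanges the coordinates. -/
def swap (F : Subfield ℝ) : Space F 2 ≃ᵃ[F] Space F 2 := affine 0 1 1 0 0 0 (by simp)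

theorem swap_image_rectangle : swap F '' rectangle 1 = rectangle 1 := by
  ext x
  rw [mem_image_affineEquiv]
  simp [rectangle, swap]
  tauto

theorem scissorsCongruent_rectangle_self (d : F) :
    ScissorsCongruent (rectangle d) (rectangle d) := by
  simpa using ScissorsCongruent.of_image .refl (polyhedral_rectangle d) (coordBounded_rectangle d)

theorem scissorsCongruent_swap :
    ScissorsCongruent (rectangle (1 : F)) (swap F '' rectangle 1) := by
  rw [swap_image_rectangle]
  exact scissorsCongruent_rectangle_self 1

theorem scissorsCongruent_swap_shear_swap (k : F) : ScissorsCongruent (rectangle (1 : F))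
    (((swap F).trans ((shear k).trans (swap F))) '' rectangle 1) := by
  have h := (scissorsCongruent_shear k).image (swap F)
  rw [swap_image_rectangle, image_image] at h
  have h2 : ((swap F).trans ((shear k).trans (swap F))) '' rectangle 1 =
      (fun x => swap F (shear k x)) '' (swap F '' rectangle 1) := by
    rw [image_image]
    rfl
  rwa [h2, swap_image_rectangle]

/-- The reflection `x ↦ (x₀, -x₁)`. -/
def conjugation (F : Subfield ℝ) : Space F 2 ≃ᵃ[F] Space F 2 := affine 1 0 0 (-1) 0 0 (by simp)

/-- The reflected square and the translate of the square by (0, −1) differ only on boundary lines.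
-/
theorem scissorsCongruent_conjugation :
    ScissorsCongruent (rectangle (1 : F)) (conjugation F '' rectangle 1) := by
  refine (ScissorsCongruent.of_image (isTranslationOrReflection_translation 0 (-1))
    (polyhedral_rectangle 1) (coordBounded_rectangle 1)).congr (EventuallyEq.refl _ _) ?_
  filter_upwards [eventually_ne (F := F) 0 1 0 (Or.inr one_ne_zero),
    eventually_ne (F := F) 0 1 1 (Or.inr one_ne_zero)] with x h0 h1
  apply propext
  change x ∈ translation (0 : F) (-1) '' rectangle 1 ↔ x ∈ conjugation F '' rectangle 1
  rw [mem_image_affineEquiv, mem_image_affineEquiv]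
  simp only [rectangle, translation, conjugation, mem_ofPred_eq, affine_symm_apply_zero,
    affine_symm_apply_one]
  norm_num [div_neg] at h0 h1 ⊢
  intro _ _
  constructor
  · rintro ⟨h2, h3⟩
    exact ⟨h3.le, lt_of_le_of_ne (by linarith) fun h => h1 (by linarith)⟩
  · rintro ⟨h2, h3⟩
    exact ⟨by linarith, lt_of_le_of_ne h2 h0⟩

theorem affine_image_rectangle {r : F} (hr : 0 < r) {h : 1 * r - 0 * 0 ≠ 0} :
    affine 1 0 0 r 0 0 h '' rectangle 1 = rectangle r := by
  ext x
  rw [mem_image_affineEquiv]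
  simp [rectangle, hr.ne', div_lt_one hr, le_div_iff₀ hr]

/-- Precomposing with a shear or swap is a column operation and leaves the image of the square
unchanged up to scissors congruence. Such operations reduce the matrix to diag(1, r), up to a sign
handled by `conjugation`. -/
theorem exists_scissorsCongruent_rectangle_of_linear (a b c d : F) (h : a * d - b * c ≠ 0) :
    ∃ r : F, 0 ≤ r ∧ ScissorsCongruent (affine a b c d 0 0 h '' rectangle 1) (rectangle r) := by
  have hdiag : ∀ (r : F) (h : 1 * r - 0 * 0 ≠ 0), ∃ r' : F, 0 ≤ r' ∧
      ScissorsCongruent (affine 1 0 0 r 0 0 h '' rectangle 1) (rectangle r') := by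
    intro r h
    have hr : r ≠ 0 := by simpa using h
    rcases hr.lt_or_gt with hr | hr
    · refine ⟨-r, by linarith, scissorsCongruent_conjugation.image_trans ?_⟩
      have : (conjugation F).trans (affine 1 0 0 r 0 0 h) =
          affine 1 0 0 (-r) 0 0 (by simpa using hr.ne) :=
        affineEquiv_ext (by simp [conjugation]) (by simp [conjugation])
      rw [this, affine_image_rectangle (by linarith)]
      exact scissorsCongruent_rectangle_self _
    · exact ⟨r, hr.le, by rw [affine_image_rectangle hr]; exact scissorsCongruent_rectangle_self _⟩
  have hb : ∀ (a b c d : F) (h : a * d - b * c ≠ 0), b ≠ 0 → ∃ r : F, 0 ≤ r ∧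
      ScissorsCongruent (affine a b c d 0 0 h '' rectangle 1) (rectangle r) := by
    intro a b c d h hb
    -- Adding (1 − a)/b times column two to column one makes the top left entry 1 and the bottom
    -- left entry c'. The next two shears clear b and c'.
    set c' : F := c + d * ((1 - a) / b) with hc'
    have hD : d - b * c' = a * d - b * c := by
      rw [hc']
      field_simp
      ring
    obtain ⟨r, hr, h1⟩ := hdiag (a * d - b * c) (by simpa using h)
    refine ⟨r, hr, (scissorsCongruent_swap_shear_swap ((1 - a) / b)).image_trans
      ((scissorsCongruent_shear (-b)).image_trans
      ((scissorsCongruent_swap_shear_swap (-c' / (a * d - b * c))).image_trans ?_))⟩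
    convert h1 using 2
    congr 1
    refine affineEquiv_ext (fun x => ?_) fun x => ?_
    · simp [swap, shear]
      field_simp
      ring
    · have he : (a * d - b * c) * (-c' / (a * d - b * c)) = -c' := mul_div_cancel₀ _ h
      simp [swap, shear]
      generalize -c' / (a * d - b * c) = q at *
      generalize (1 - a) / b = k at *
      linear_combination x 0 * he + (x 1 + q * x 0) * hD - (x 0 - b * (x 1 + q * x 0)) * hc'
  by_cases hb0 : b = 0
  · have ha : a ≠ 0 := by
      rintro rfl
      simp [hb0] at h
    obtain ⟨r, hr, h1⟩ := hb b a d c (fun h0 => h (by linear_combination -h0)) ha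
    refine ⟨r, hr, scissorsCongruent_swap.image_trans ?_⟩
    convert h1 using 2
    congr 1
    exact affineEquiv_ext (fun x => by simp [swap, add_comm]) fun x => by simp [swap, add_comm]
  · exact hb a b c d h hb0

theorem exists_scissorsCongruent_rectangle_of_affine (φ : Space F 2 ≃ᵃ[F] Space F 2) :
    ∃ r : F, 0 ≤ r ∧ ScissorsCongruent (φ '' rectangle 1) (rectangle r) := by
  obtain ⟨a, b, c, d, s, t, h, rfl⟩ := exists_eq_affine φ
  obtain ⟨r, hr, h1⟩ := exists_scissorsCongruent_rectangle_of_linear a b c d h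
  refine ⟨r, hr, ScissorsCongruent.trans (ScissorsCongruent.symm ?_) h1⟩
  have := ScissorsCongruent.of_image (isTranslationOrReflection_translation s t)
    ((polyhedral_rectangle 1).image (affine a b c d 0 0 h))
    ((coordBounded_rectangle 1).image (affine a b c d 0 0 h))
  rw [image_image] at this
  have heq : (fun x => translation s t (affine a b c d 0 0 h x)) = affine a b c d s t h := by
    funext x i
    fin_cases i <;> simp [translation]
  rwa [heq] at this

/-! ### Triangles -/

/-- The triangle with vertices `(0, 0)`, `(1, 0)`, `(0, 1)`. -/
def stdTriangle (F : Subfield ℝ) : Set (Space F 2) := {x | 0 ≤ x 0 ∧ 0 ≤ x 1 ∧ x 0 + x 1 ≤ 1}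

theorem mem_image_stdTriangle {φ : Space F 2 ≃ᵃ[F] Space F 2} {x : Space F 2} :
    x ∈ φ '' stdTriangle F ↔
      0 ≤ φ.symm x 0 ∧ 0 ≤ φ.symm x 1 ∧ φ.symm x 0 + φ.symm x 1 ≤ 1 :=
  mem_image_affineEquiv

theorem coordBounded_stdTriangle : CoordBounded (stdTriangle F) := by
  refine ⟨1, ?_⟩
  rintro x ⟨h0, h1, h2⟩ i
  fin_cases i
  · exact (abs_of_nonneg h0).trans_le (by linarith)
  · exact (abs_of_nonneg h1).trans_le (by linarith)

theorem isConvexPolytope_image_stdTriangle (φ : Space F 2 ≃ᵃ[F] Space F 2) :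
    IsConvexPolytope (φ '' stdTriangle F) := by
  classical
  refine ⟨(coordBounded_stdTriangle.image φ).isBounded,
    ({functional 1 0 0, functional 0 1 0, functional (-1) (-1) 1} :
      Finset (Space F 2 →ᵃ[F] F)).image fun ξ => ξ.comp φ.symm.toAffineMap, ?_, ?_⟩
  · intro ξ hξ
    obtain ⟨η, hη, rfl⟩ := Finset.mem_image.1 hξ
    refine Regular.comp ?_ φ.symm
    simp only [Finset.mem_insert, Finset.mem_singleton] at hη
    rcases hη with rfl | rfl | rfl
    exacts [regular_functional _ (by simp), regular_functional _ (by simp),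
      regular_functional _ (by simp)]
  · ext x
    rw [mem_image_stdTriangle]
    simp [closedHalfSpace]
    intro _ _
    constructor <;> intro h <;> linarith

theorem image_stdTriangle_nonempty (φ : Space F 2 ≃ᵃ[F] Space F 2) :
    (φ '' stdTriangle F).Nonempty :=
  Nonempty.image _ ⟨0, by simp [stdTriangle]⟩

theorem rank_image_stdTriangle (φ : Space F 2 ≃ᵃ[F] Space F 2) :
    rank (φ '' stdTriangle F) = 2 := by
  have key : ∀ v ∈ stdTriangle F,
      φ.linear v ∈ (affineSpan F (φ '' stdTriangle F)).direction := by
    intro v hv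
    have h1 : φ.linear v = φ v -ᵥ φ 0 := by
      have := φ.toAffineMap.linearMap_vsub v 0
      rw [vsub_eq_sub v 0, sub_zero] at this
      exact this
    rw [h1]
    exact AffineSubspace.vsub_mem_direction
      (subset_affineSpan F _ (mem_image_of_mem _ hv))
      (subset_affineSpan F _ (mem_image_of_mem _ (by simp [stdTriangle])))
  have htop : (affineSpan F (φ '' stdTriangle F)).direction = ⊤ := by
    rw [eq_top_iff]
    rintro v -
    obtain ⟨w, rfl⟩ := φ.linear.surjective v
    have hw : w = w 0 • ![1, 0] + w 1 • ![0, 1] := by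
      funext i
      fin_cases i <;> simp
    rw [hw, map_add, map_smul, map_smul]
    exact Submodule.add_mem _ (Submodule.smul_mem _ _ (key _ (by simp [stdTriangle])))
      (Submodule.smul_mem _ _ (key _ (by simp [stdTriangle])))
  rw [rank, htop, finrank_top, Module.finrank_fin_fun]

theorem isPolygon_image_stdTriangle (φ : Space F 2 ≃ᵃ[F] Space F 2) :
    IsPolygon (φ '' stdTriangle F) := by
  refine ⟨{φ '' stdTriangle F}, finite_singleton _, ?_, (sUnion_singleton _).symm⟩
  rintro _ rfl
  exact ⟨isConvexPolytope_image_stdTriangle φ, image_stdTriangle_nonempty φ,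
    rank_image_stdTriangle φ⟩

theorem polyhedral_stdTriangle : Polyhedral (stdTriangle F) := by
  simpa using (isConvexPolytope_image_stdTriangle (.refl F (Space F 2))).polyhedral

/-- Cut at height 1/2 and turn the upper triangle by a half-turn about the midpoint (1/2, 1/2) of
the hypotenuse; it fills the gap beside the trapezoid. -/
theorem scissorsCongruent_stdTriangle :
    ScissorsCongruent (stdTriangle F) (rectangle (1 / 2)) := by
  let ρ : Space F 2 ≃ᵃ[F] Space F 2 := affine (-1) 0 0 (-1) 1 1 (by simp)
  have hρ : IsTranslationOrReflection ρ := by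
    refine ⟨-1, Or.inr rfl, fun x y => ?_⟩
    funext i
    fin_cases i <;> simp [ρ, affine_apply] <;> ring
  have hp := polyhedral_neg (F := F) 0 1 (-(1 / 2)) (Or.inr one_ne_zero)
  refine ⟨Bool, inferInstance,
    fun b => stdTriangle F ∩ cond b {x | 0 * x 0 + 1 * x 1 + -(1 / 2) < 0}
      {x | 0 * x 0 + 1 * x 1 + -(1 / 2) < 0}ᶜ,
    fun b => cond b (.refl F (Space F 2)) ρ, ?_, ?_, ?_, ?_⟩
  · rintro (_ | _)
    · exact ⟨polyhedral_stdTriangle.inter hp.compl, coordBounded_stdTriangle.mono inter_subset_left⟩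
    · exact ⟨polyhedral_stdTriangle.inter hp, coordBounded_stdTriangle.mono inter_subset_left⟩
  · rintro (_ | _)
    exacts [hρ, .refl]
  · refine Eventually.of_forall fun x => ?_
    simp only [Bool.forall_bool, Bool.exists_bool, cond_true, cond_false, mem_inter_iff,
      mem_compl_iff]
    tauto
  · filter_upwards [eventually_ne (F := F) 1 0 (-1) (Or.inl one_ne_zero),
      eventually_ne (F := F) 0 1 (-(1 / 2)) (Or.inr one_ne_zero),
      eventually_ne (F := F) 1 1 (-1) (Or.inr one_ne_zero)] with x h1 h2 h3
    have e1 : x ∈ ρ '' (stdTriangle F ∩ {x | 0 * x 0 + 1 * x 1 + -(1 / 2) < 0}ᶜ) ↔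
        x 0 ≤ 1 ∧ x 1 ≤ 1 / 2 ∧ 1 ≤ x 0 + x 1 := by
      rw [mem_image_affineEquiv]
      simp only [stdTriangle, mem_inter_iff, mem_compl_iff, mem_ofPred_eq, ρ,
        affine_symm_apply_zero, affine_symm_apply_one, not_lt]
      norm_num [div_neg]
      constructor
      · rintro ⟨⟨h1, h2, h3⟩, h4⟩
        exact ⟨h1, by linarith, by linarith⟩
      · rintro ⟨h1, h2, h3⟩
        exact ⟨⟨h1, by linarith, by linarith⟩, by linarith⟩
    have e2 : x ∈ AffineEquiv.refl F (Space F 2) ''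
        (stdTriangle F ∩ {x | 0 * x 0 + 1 * x 1 + -(1 / 2) < 0}) ↔
        0 ≤ x 0 ∧ 0 ≤ x 1 ∧ x 0 + x 1 ≤ 1 ∧ x 1 < 1 / 2 := by
      rw [AffineEquiv.coe_refl, image_id]
      simp only [stdTriangle, mem_inter_iff, mem_ofPred_eq, and_assoc]
      refine and_congr_right fun _ => and_congr_right fun _ => and_congr_right fun _ => ?_
      constructor <;> intro h <;> linarith
    have h1' : x 0 ≠ 1 := fun h => h1 (by rw [h]; ring)
    have h2' : x 1 ≠ 1 / 2 := fun h => h2 (by rw [h]; ring)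
    have h3' : x 0 + x 1 ≠ 1 := fun h => h3 (by linear_combination h)
    simp only [Bool.forall_bool, Bool.exists_bool, cond_true, cond_false]
    rw [e1, e2]
    simp only [rectangle, mem_ofPred_eq]
    refine ⟨⟨⟨fun _ _ => trivial, fun h h' => ?_⟩, fun h h' => ?_, fun _ _ => trivial⟩, ?_, ?_⟩
    · exact absurd (le_antisymm h'.2.2.1 h.2.2) h3'
    · exact absurd (le_antisymm h.2.2.1 h'.2.2) h3'
    · rintro ⟨h0, h1, h2, h3⟩
      rcases le_total (x 0 + x 1) 1 with h | h
      · exact Or.inr ⟨h0, h2, h, h3⟩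
      · exact Or.inl ⟨h1.le, h3.le, h⟩
    · rintro (⟨h0, h1, h2⟩ | ⟨h0, h1, h2, h3⟩)
      · exact ⟨by linarith, lt_of_le_of_ne h0 h1', by linarith, lt_of_le_of_ne h1 h2'⟩
      · exact ⟨h0, lt_of_le_of_ne (by linarith) h1', h1, h3⟩

theorem exists_scissorsCongruent_rectangle_of_triangle (φ : Space F 2 ≃ᵃ[F] Space F 2) :
    ∃ r : F, 0 ≤ r ∧ ScissorsCongruent (φ '' stdTriangle F) (rectangle r) := by
  have h := (scissorsCongruent_stdTriangle (F := F)).image φ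
  rw [← affine_image_rectangle (h := by norm_num) (by norm_num : (0 : F) < 1 / 2), image_image] at h
  obtain ⟨r, hr, h'⟩ := exists_scissorsCongruent_rectangle_of_affine
    ((affine 1 0 0 (1 / 2) 0 0 (by norm_num)).trans φ)
  exact ⟨r, hr, h.trans h'⟩

/-! ### Triangulations -/

/-- Up to finitely many lines, `S` is a disjoint union of triangles that do not cross the
line `ξ = 0`. -/
def Splits (S : Set (Space F 2)) (ξ : Space F 2 →ᵃ[F] F) : Prop :=
  ∃ (ι : Type) (_ : Fintype ι) (φ : ι → Space F 2 ≃ᵃ[F] Space F 2),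
    AEPartition S (fun i => φ i '' stdTriangle F) ∧
    ∀ i, (∀ x ∈ φ i '' stdTriangle F, 0 ≤ ξ x) ∨ ∀ x ∈ φ i '' stdTriangle F, ξ x ≤ 0

theorem Splits.image {S : Set (Space F 2)} {ξ : Space F 2 →ᵃ[F] F}
    {φ : Space F 2 ≃ᵃ[F] Space F 2} (h : Splits S (ξ.comp φ.toAffineMap)) :
    Splits (φ '' S) ξ := by
  obtain ⟨ι, _, ψ, h, hs⟩ := h
  have himage : ∀ i, ((ψ i).trans φ) '' stdTriangle F = φ '' (ψ i '' stdTriangle F) := fun i => by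
    rw [image_image]
    rfl
  refine ⟨ι, inferInstance, fun i => (ψ i).trans φ, ?_, fun i => ?_⟩
  · simpa only [himage] using h.image φ
  · rw [himage]
    exact (hs i).imp forall_mem_image.2 forall_mem_image.2

theorem AEPartition.splits {ι : Type} [Fintype ι] {S : Set (Space F 2)}
    {A : ι → Set (Space F 2)} {ξ : Space F 2 →ᵃ[F] F} (h : AEPartition S A)
    (hA : ∀ i, Splits (A i) ξ) : Splits S ξ := by
  choose κ hκ φ hφ hs using hA
  exact ⟨Σ i, κ i, inferInstance, fun p => φ p.1 p.2, h.sigma hφ, fun p => hs p.1 p.2⟩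

theorem splits_stdTriangle_of_forall {ξ : Space F 2 →ᵃ[F] F}
    (h : (∀ x ∈ stdTriangle F, 0 ≤ ξ x) ∨ ∀ x ∈ stdTriangle F, ξ x ≤ 0) :
    Splits (stdTriangle F) ξ :=
  ⟨Unit, inferInstance, fun _ => .refl F _, Eventually.of_forall fun x => by simp,
    fun _ => by simpa using h⟩

/-- The affine functional with prescribed values at the vertices of the standard triangle. -/
def vertexFunctional (p q r : F) : Space F 2 →ᵃ[F] F := functional (q - p) (r - p) p

theorem vertexFunctional_apply (p q r : F) (x : Space F 2) :
    vertexFunctional p q r x = (1 - x 0 - x 1) * p + x 0 * q + x 1 * r := by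
  simp only [vertexFunctional, functional_apply]
  ring

theorem splits_vertexFunctional_of_nonneg {p q r : F} (hp : 0 ≤ p) (hq : 0 ≤ q) (hr : 0 ≤ r) :
    Splits (stdTriangle F) (vertexFunctional p q r) := by
  refine splits_stdTriangle_of_forall (Or.inl ?_)
  rintro x ⟨h0, h1, h2⟩
  rw [vertexFunctional_apply]
  have h3 : 0 ≤ 1 - x 0 - x 1 := by linarith
  positivity

theorem splits_vertexFunctional_of_nonpos {p q r : F} (hp : p ≤ 0) (hq : q ≤ 0) (hr : r ≤ 0) :
    Splits (stdTriangle F) (vertexFunctional p q r) := by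
  refine splits_stdTriangle_of_forall (Or.inr ?_)
  rintro x ⟨h0, h1, h2⟩
  rw [vertexFunctional_apply]
  have h3 : 0 ≤ 1 - x 0 - x 1 := by linarith
  have := mul_nonpos_of_nonneg_of_nonpos h3 hp
  have := mul_nonpos_of_nonneg_of_nonpos h0 hq
  have := mul_nonpos_of_nonneg_of_nonpos h1 hr
  linarith

/-- An affine symmetry of the triangle exchanges two vertices and hence the values there. With the
next lemma, vertices can be permuted freely. -/
theorem splits_vertexFunctional_swap_left {p q r : F}
    (h : Splits (stdTriangle F) (vertexFunctional q p r)) :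
    Splits (stdTriangle F) (vertexFunctional p q r) := by
  let σ : Space F 2 ≃ᵃ[F] Space F 2 := affine (-1) (-1) 0 1 1 0 (by simp)
  have himage : σ '' stdTriangle F = stdTriangle F := by
    ext x
    rw [mem_image_stdTriangle]
    simp only [σ, affine_symm_apply_zero, affine_symm_apply_one]
    norm_num [div_neg, stdTriangle]
    constructor <;> rintro ⟨h1, h2, h3⟩ <;> exact ⟨by linarith, by linarith, by linarith⟩
  rw [← himage]
  apply Splits.image
  convert h using 1
  refine AffineMap.ext fun x => ?_
  change vertexFunctional p q r (σ x) = _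
  rw [vertexFunctional_apply, vertexFunctional_apply, affine_apply_zero, affine_apply_one]
  ring

theorem splits_vertexFunctional_swap_right {p q r : F}
    (h : Splits (stdTriangle F) (vertexFunctional p r q)) :
    Splits (stdTriangle F) (vertexFunctional p q r) := by
  have himage : swap F '' stdTriangle F = stdTriangle F := by
    ext x
    rw [mem_image_stdTriangle]
    simp only [swap, affine_symm_apply_zero, affine_symm_apply_one]
    norm_num [stdTriangle]
    constructor <;> rintro ⟨h1, h2, h3⟩ <;> exact ⟨by linarith, by linarith, by linarith⟩
  rw [← himage]
  apply Splits.image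
  convert h using 1
  refine AffineMap.ext fun x => ?_
  change vertexFunctional p q r (swap F x) = _
  rw [vertexFunctional_apply, vertexFunctional_apply, swap, affine_apply_zero, affine_apply_one]
  ring

/-- Cut the triangle by the line through the vertex `(0, 0)` and a point of the opposite side. -/
theorem aePartition_stdTriangle {t : F} (h0 : 0 < t) (h1 : t < 1)
    {h : 1 * t - (1 - t) * 0 ≠ 0} {h' : (1 - t) * 1 - 0 * t ≠ 0} :
    AEPartition (stdTriangle F) fun b : Bool =>
      cond b (affine 1 (1 - t) 0 t 0 0 h) (affine (1 - t) 0 t 1 0 0 h') '' stdTriangle F := by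
  have h1' : 0 < 1 - t := by linarith
  filter_upwards [eventually_ne t (-(1 - t)) 0 (Or.inl h0.ne')] with x hx
  have e1 : x ∈ affine 1 (1 - t) 0 t 0 0 h '' stdTriangle F ↔
      0 ≤ t * x 0 - (1 - t) * x 1 ∧ 0 ≤ x 1 ∧ x 0 + x 1 ≤ 1 := by
    rw [mem_image_stdTriangle]
    simp only [affine_symm_apply_zero, affine_symm_apply_one]
    rw [show 1 * t - (1 - t) * 0 = t by ring, ← add_div, div_le_one h0, le_div_iff₀ h0,
      le_div_iff₀ h0]
    constructor
    · rintro ⟨h1, h2, h3⟩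
      exact ⟨by linarith, by linarith, by nlinarith⟩
    · rintro ⟨h1, h2, h3⟩
      exact ⟨by linarith, by linarith, by nlinarith⟩
  have e2 : x ∈ affine (1 - t) 0 t 1 0 0 h' '' stdTriangle F ↔
      t * x 0 - (1 - t) * x 1 ≤ 0 ∧ 0 ≤ x 0 ∧ x 0 + x 1 ≤ 1 := by
    rw [mem_image_stdTriangle]
    simp only [affine_symm_apply_zero, affine_symm_apply_one]
    rw [show (1 - t) * 1 - 0 * t = 1 - t by ring, ← add_div, div_le_one h1', le_div_iff₀ h1',
      le_div_iff₀ h1']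
    constructor
    · rintro ⟨h1, h2, h3⟩
      exact ⟨by linarith, by linarith, by nlinarith⟩
    · rintro ⟨h1, h2, h3⟩
      exact ⟨by linarith, by linarith, by nlinarith⟩
  have hx' : t * x 0 - (1 - t) * x 1 ≠ 0 := fun h => hx (by linear_combination h)
  simp only [Bool.forall_bool, Bool.exists_bool, cond_true, cond_false]
  rw [e1, e2]
  simp only [stdTriangle, mem_ofPred_eq]
  refine ⟨⟨⟨fun _ _ => trivial, fun h h' => ?_⟩, fun h h' => ?_, fun _ _ => trivial⟩, ?_, ?_⟩
  · exact absurd (le_antisymm h.1 h'.1) hx'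
  · exact absurd (le_antisymm h'.1 h.1) hx'
  · rintro ⟨h2, h3, h4⟩
    rcases le_total (t * x 0 - (1 - t) * x 1) 0 with h | h
    exacts [Or.inl ⟨h, h2, h4⟩, Or.inr ⟨h, h3, h4⟩]
  · rintro (⟨h2, h3, h4⟩ | ⟨h2, h3, h4⟩)
    · exact ⟨h3, by nlinarith, h4⟩
    · exact ⟨by nlinarith, h3, h4⟩

/-- Opposite signs at two vertices give a zero on the side between them. Cutting from the third
vertex to that zero leaves two triangles with a vertex of value 0. -/
theorem splits_vertexFunctional_of_mul_neg {p q r : F} (hqr : q * r < 0)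
    (h1 : Splits (stdTriangle F) (vertexFunctional p q 0))
    (h2 : Splits (stdTriangle F) (vertexFunctional p 0 r)) :
    Splits (stdTriangle F) (vertexFunctional p q r) := by
  obtain ⟨t, ht0, ht1, ht⟩ : ∃ t : F, 0 < t ∧ t < 1 ∧ (1 - t) * q + t * r = 0 := by
    have hne : q - r ≠ 0 := fun h => by
      rw [sub_eq_zero.1 h] at hqr
      exact absurd hqr (not_lt.2 (mul_self_nonneg r))
    refine ⟨q / (q - r), ?_, ?_, by field_simp; ring⟩ <;>
    rcases mul_neg_iff.1 hqr with ⟨hq, hr⟩ | ⟨hq, hr⟩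
    · exact div_pos hq (by linarith)
    · exact div_pos_of_neg_of_neg hq (by linarith)
    · exact (div_lt_one (by linarith)).2 (by linarith)
    · exact (div_lt_one_of_neg (by linarith)).2 (by linarith)
  refine (aePartition_stdTriangle ht0 ht1 (h := by simpa using ht0.ne')
    (h' := by simpa using (sub_pos.2 ht1).ne')).splits ?_
  rintro (_ | _) <;> apply Splits.image
  · convert h2 using 1
    refine AffineMap.ext fun x => ?_
    change vertexFunctional p q r (affine (1 - t) 0 t 1 0 0 _ x) = _
    rw [vertexFunctional_apply, vertexFunctional_apply, affine_apply_zero, affine_apply_one]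
    linear_combination x 0 * ht
  · convert h1 using 1
    refine AffineMap.ext fun x => ?_
    change vertexFunctional p q r (affine 1 (1 - t) 0 t 0 0 _ x) = _
    rw [vertexFunctional_apply, vertexFunctional_apply, affine_apply_zero, affine_apply_one]
    linear_combination x 1 * ht

theorem splits_vertexFunctional_zero (p q : F) :
    Splits (stdTriangle F) (vertexFunctional p q 0) := by
  rcases lt_or_ge (p * q) 0 with h | h
  -- Move the value 0 to the first vertex; the cut then yields triangles with two zero vertices, on
  -- which the sign is constant.
  · apply splits_vertexFunctional_swap_right
    apply splits_vertexFunctional_swap_left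
    apply splits_vertexFunctional_of_mul_neg h
    · rcases le_total p 0 with hp | hp
      exacts [splits_vertexFunctional_of_nonpos le_rfl hp le_rfl,
        splits_vertexFunctional_of_nonneg le_rfl hp le_rfl]
    · rcases le_total q 0 with hq | hq
      exacts [splits_vertexFunctional_of_nonpos le_rfl le_rfl hq,
        splits_vertexFunctional_of_nonneg le_rfl le_rfl hq]
  · rcases mul_nonneg_iff.1 h with ⟨hp, hq⟩ | ⟨hp, hq⟩
    exacts [splits_vertexFunctional_of_nonneg hp hq le_rfl,
      splits_vertexFunctional_of_nonpos hp hq le_rfl]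

theorem splits_vertexFunctional (p q r : F) :
    Splits (stdTriangle F) (vertexFunctional p q r) := by
  have key : ∀ {p q r : F}, q * r < 0 → Splits (stdTriangle F) (vertexFunctional p q r) :=
    fun h => splits_vertexFunctional_of_mul_neg h (splits_vertexFunctional_zero _ _)
      (splits_vertexFunctional_swap_right (splits_vertexFunctional_zero _ _))
  rcases lt_or_ge (q * r) 0 with hqr | hqr
  · exact key hqr
  rcases lt_or_ge (p * r) 0 with hpr | hpr
  · exact splits_vertexFunctional_swap_left (key hpr)
  rcases lt_or_ge (p * q) 0 with hpq | hpq
  · exact splits_vertexFunctional_swap_right (splits_vertexFunctional_swap_left (key hpq))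
  rcases lt_trichotomy p 0 with hp | rfl | hp
  · exact splits_vertexFunctional_of_nonpos hp.le (by nlinarith) (by nlinarith)
  · rcases mul_nonneg_iff.1 hqr with ⟨hq, hr⟩ | ⟨hq, hr⟩
    exacts [splits_vertexFunctional_of_nonneg le_rfl hq hr,
      splits_vertexFunctional_of_nonpos le_rfl hq hr]
  · exact splits_vertexFunctional_of_nonneg hp.le (by nlinarith) (by nlinarith)

theorem splits_triangle (φ : Space F 2 ≃ᵃ[F] Space F 2) (ξ : Space F 2 →ᵃ[F] F) :
    Splits (φ '' stdTriangle F) ξ := by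
  apply Splits.image
  obtain ⟨a, b, c, h⟩ := exists_eq_functional (ξ.comp φ.toAffineMap)
  have : ξ.comp φ.toAffineMap = vertexFunctional c (a + c) (b + c) := by
    rw [h, vertexFunctional, add_sub_cancel_right, add_sub_cancel_right]
  rw [this]
  exact splits_vertexFunctional _ _ _

/-- Cut along one line at a time; signs already constant on a triangle remain so on its parts. -/
theorem exists_aePartition_triangle_sign {Ξ : Set (Space F 2 →ᵃ[F] F)} (hf : Ξ.Finite)
    (hr : ∀ ξ ∈ Ξ, Regular ξ) (φ₀ : Space F 2 ≃ᵃ[F] Space F 2) :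
    ∃ (ι : Type) (_ : Fintype ι) (φ : ι → Space F 2 ≃ᵃ[F] Space F 2),
      AEPartition (φ₀ '' stdTriangle F) (fun i => φ i '' stdTriangle F) ∧
      ∀ i, ∀ ξ ∈ Ξ, ∃ σ : SignType, ∀ᶠ x in generic F, x ∈ φ i '' stdTriangle F →
        SignType.sign (ξ x) = σ := by
  induction Ξ, hf using Set.Finite.induction_on with
  | empty =>
    exact ⟨Unit, inferInstance, fun _ => φ₀, Eventually.of_forall fun x => by simp, by simp⟩
  | @insert ξ Ξ _ _ ih =>
    obtain ⟨ι, _, φ, hφ, hσ⟩ := ih fun ξ hξ => hr ξ (mem_insert_of_mem _ hξ)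
    choose κ _ ψ hψ hs using fun i => splits_triangle (φ i) ξ
    refine ⟨Σ i, κ i, inferInstance, fun p => ψ p.1 p.2, hφ.sigma hψ, ?_⟩
    rintro ⟨i, k⟩ η (rfl | hη)
    · have hne := (hr η (mem_insert _ _)).eventually_ne
      rcases hs i k with h | h
      · refine ⟨1, hne.mono fun x hx hxk => sign_pos ?_⟩
        exact lt_of_le_of_ne (h x hxk) hx.symm
      · refine ⟨-1, hne.mono fun x hx hxk => sign_neg ?_⟩
        exact lt_of_le_of_ne (h x hxk) hx
    · obtain ⟨σ, h⟩ := hσ i η hη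
      refine ⟨σ, ?_⟩
      filter_upwards [h, hψ i] with x hx hxi hxk
      exact hx (hxi.2.2 ⟨k, hxk⟩)

theorem CoordBounded.exists_subset_triangle {S : Set (Space F 2)} (h : CoordBounded S) :
    ∃ φ : Space F 2 ≃ᵃ[F] Space F 2, S ⊆ φ '' stdTriangle F := by
  obtain ⟨R, hR⟩ := h
  have hM : 0 < max R 1 := lt_of_lt_of_le one_pos (le_max_right _ _)
  have hM' : ∀ x ∈ S, ∀ i, |x i| ≤ max R 1 := fun x hx i => (hR x hx i).trans (le_max_left _ _)
  generalize max R 1 = M at *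
  have hM4 : 0 < 4 * M := by linarith
  -- The right triangle with corner (−M, −M) and legs 4M has hypotenuse x₀ + x₁ = 2M, so it contains
  -- the square [−M, M]².
  refine ⟨affine (4 * M) 0 0 (4 * M) (-M) (-M) (by simpa using hM.ne'), fun x hx => ?_⟩
  have h0 := abs_le.1 (hM' x hx 0)
  have h1 := abs_le.1 (hM' x hx 1)
  rw [mem_image_stdTriangle, affine_symm_apply_zero, affine_symm_apply_one, ← add_div]
  have hpos : 0 < 4 * M * (4 * M) - 0 * 0 := by nlinarith
  rw [div_le_one hpos]
  refine ⟨div_nonneg ?_ hpos.le, div_nonneg ?_ hpos.le, ?_⟩ <;> nlinarith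

/-- Cut an enclosing triangle along the lines of `S`. Each part then has constant signs, so up to
lines it lies inside or outside `S`; keep the inner ones. -/
theorem Polyhedral.exists_aePartition_triangle {S : Set (Space F 2)} (hS : Polyhedral S)
    (hb : CoordBounded S) : ∃ (ι : Type) (_ : Fintype ι) (φ : ι → Space F 2 ≃ᵃ[F] Space F 2),
      AEPartition S fun i => φ i '' stdTriangle F := by
  classical
  obtain ⟨φ₀, hφ₀⟩ := hb.exists_subset_triangle
  obtain ⟨Ξ, hf, hr, h⟩ := hS
  obtain ⟨ι, _, φ, hφ, hσ⟩ := exists_aePartition_triangle_sign hf hr φ₀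
  have key : ∀ i, (∀ᶠ x in generic F, x ∈ φ i '' stdTriangle F → x ∈ S) ∨
      ∀ᶠ x in generic F, x ∈ φ i '' stdTriangle F → x ∉ S := by
    intro i
    choose! σ hσ using hσ i
    have hall : ∀ᶠ x in generic F, ∀ ξ ∈ Ξ, x ∈ φ i '' stdTriangle F →
      SignType.sign (ξ x) = σ ξ := (eventually_all_finite hf).2 hσ
    by_cases hex : ∃ y ∈ S, ∀ ξ ∈ Ξ, SignType.sign (ξ y) = σ ξ
    · obtain ⟨y, hyS, hy⟩ := hex
      left
      filter_upwards [hall] with x hx hxi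
      exact (h x y fun ξ hξ => (hx ξ hξ hxi).trans (hy ξ hξ).symm).2 hyS
    · right
      filter_upwards [hall] with x hx hxi hxS
      exact hex ⟨x, hxS, fun ξ hξ => hx ξ hξ hxi⟩
  refine ⟨{i // ∀ᶠ x in generic F, x ∈ φ i '' stdTriangle F → x ∈ S}, inferInstance,
    fun i => φ i, ?_⟩
  have hin : ∀ᶠ x in generic F, ∀ i : {i // ∀ᶠ x in generic F, x ∈ φ i '' stdTriangle F → x ∈ S},
      x ∈ φ i '' stdTriangle F → x ∈ S := eventually_all.2 fun i => i.2
  have hout : ∀ᶠ x in generic F,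
      ∀ i, x ∈ φ i '' stdTriangle F → x ∈ S →
        ∀ᶠ x in generic F, x ∈ φ i '' stdTriangle F → x ∈ S := by
    refine eventually_all.2 fun i => ?_
    rcases key i with hi | hi
    · exact Eventually.of_forall fun x _ _ => hi
    · exact hi.mono fun x hx hxi hxS => absurd hxS (hx hxi)
  filter_upwards [hφ, hin, hout] with x hx hxin hxout
  refine ⟨fun i j hi hj => Subtype.ext (hx.1 i j hi hj), fun hxS => ?_, fun ⟨i, hi⟩ => hxin i hi⟩
  obtain ⟨i, hi⟩ := hx.2.1 (hφ₀ hxS)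
  exact ⟨⟨i, hxout i hi hxS⟩, hi⟩

/-! ### The theorem of Wallace, Bolyai and Gerwien -/

theorem rectangle_add {r s : F} (hr : 0 ≤ r) (hs : 0 ≤ s) :
    rectangle r ∪ translation 0 r '' rectangle s = rectangle (r + s) := by
  ext x
  rw [mem_union, mem_image_affineEquiv]
  simp only [rectangle, translation, mem_ofPred_eq, affine_symm_apply_zero, affine_symm_apply_one]
  norm_num
  constructor
  · rintro (⟨h0, h1, h2, h3⟩ | ⟨h0, h1, h2, h3⟩)
    · exact ⟨h0, h1, h2, by linarith⟩
    · exact ⟨h0, h1, by linarith, by linarith⟩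
  · rintro ⟨h0, h1, h2, h3⟩
    rcases lt_or_ge (x 1) r with h | h
    · exact Or.inl ⟨h0, h1, h2, h⟩
    · exact Or.inr ⟨h0, h1, h, by linarith⟩

theorem ScissorsCongruent.union_rectangle {S S' : Set (Space F 2)} {r r' : F} (hr : 0 ≤ r)
    (hr' : 0 ≤ r') (h : ScissorsCongruent S (rectangle r))
    (h' : ScissorsCongruent S' (rectangle r')) (hd : ∀ᶠ x in generic F, ¬(x ∈ S ∧ x ∈ S')) :
    ScissorsCongruent (S ∪ S') (rectangle (r + r')) := by
  rw [← rectangle_add hr hr']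
  refine h.union (h'.trans (.of_image (isTranslationOrReflection_translation _ _)
    (polyhedral_rectangle _) (coordBounded_rectangle _))) hd (Eventually.of_forall fun x => ?_)
  rintro ⟨h1, h2⟩
  rw [mem_image_affineEquiv] at h2
  have h3 := h1.2.2.2
  have h4 := h2.2.2.1
  simp only [translation, affine_symm_apply_one] at h4
  norm_num at h4
  linarith

/-- Each triangle becomes a rectangle of width 1, and stacking these adds their heights. -/
theorem exists_scissorsCongruent_rectangle {S : Set (Space F 2)} (hS : Polyhedral S)
    (hb : CoordBounded S) : ∃ r : F, 0 ≤ r ∧ ScissorsCongruent S (rectangle r) := by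
  classical
  obtain ⟨ι, _, φ, h⟩ := hS.exists_aePartition_triangle hb
  have key : ∀ s : Finset ι, ∃ r : F, 0 ≤ r ∧
      ScissorsCongruent (⋃ i ∈ s, φ i '' stdTriangle F) (rectangle r) := by
    intro s
    induction s using Finset.induction_on with
    | empty =>
      refine ⟨0, le_rfl, ?_⟩
      have : rectangle (0 : F) = ∅ := eq_empty_of_forall_notMem fun x hx =>
        absurd hx.2.2.1 (not_le.2 hx.2.2.2)
      have h0 := scissorsCongruent_rectangle_self (0 : F)
      simpa [this] using h0
    | insert i s hi ih =>
      obtain ⟨r, hr, hrs⟩ := ih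
      obtain ⟨r', hr', hri⟩ := exists_scissorsCongruent_rectangle_of_triangle (φ i)
      refine ⟨r' + r, add_nonneg hr' hr, ?_⟩
      rw [Finset.set_biUnion_insert]
      refine hri.union_rectangle hr' hr hrs (h.mono fun x hx hxi => ?_)
      obtain ⟨j, hj, hxj⟩ := mem_iUnion₂.1 hxi.2
      exact hi (hx.1 i j hxi.1 hxj ▸ hj)
  obtain ⟨r, hr, h'⟩ := key Finset.univ
  refine ⟨r, hr, h'.congr ?_ (EventuallyEq.refl _ _)⟩
  filter_upwards [h] with x hx
  apply propext
  change x ∈ (⋃ i ∈ Finset.univ, φ i '' stdTriangle F) ↔ x ∈ S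
  rw [hx.2]
  simp only [mem_iUnion, Finset.mem_univ, exists_prop, true_and]

theorem scissorsCongruent_of_area_eq {S T : Set (Space F 2)} (hS : Polyhedral S)
    (hSb : CoordBounded S) (hT : Polyhedral T) (hTb : CoordBounded T) (h : area S = area T) :
    ScissorsCongruent S T := by
  obtain ⟨r, hr, h1⟩ := exists_scissorsCongruent_rectangle hS hSb
  obtain ⟨r', hr', h2⟩ := exists_scissorsCongruent_rectangle hT hTb
  have : r = r' := by
    rw [h1.area_eq, h2.area_eq, area_rectangle hr, area_rectangle hr'] at h
    exact Subtype.ext ((ENNReal.ofReal_eq_ofReal_iff hr hr').1 h)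
  subst this
  exact h1.trans h2.symm

/-! ### From partitions up to lines to refined partitions -/

/-- Forward, every germ eventually satisfies a generic property and decides the pieces. Backward,
evaluate at generic points with any one frame. -/
theorem aePartition_iff_germSet {ι : Type*} [Finite ι] {S : Set (Space F 2)}
    {A : ι → Set (Space F 2)} (hS : Polyhedral S) (hA : ∀ i, Polyhedral (A i)) :
    AEPartition S A ↔ (∀ i j, i ≠ j → Disjoint (germSet (A i)) (germSet (A j))) ∧
      germSet S = ⋃ i, germSet (A i) := by
  constructor
  · intro h
    have hz : ∀ z : RefinedSpace F 2, ∀ᶠ x in germ z,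
        (∀ i j, x ∈ A i → x ∈ A j → i = j) ∧ (x ∈ S ↔ ∃ i, x ∈ A i) :=
      fun z => germ_le_generic z h
    refine ⟨fun i j hij => disjoint_left.2 fun z hi hj => ?_, ?_⟩
    · have hi' : ∀ᶠ x in germ z, x ∈ A i := hi
      have hj' : ∀ᶠ x in germ z, x ∈ A j := hj
      obtain ⟨x, hx, hxi, hxj⟩ := ((hz z).and (hi'.and hj')).exists
      exact hij (hx.1 i j hxi hxj)
    · ext z
      rw [mem_iUnion]
      constructor
      · intro hS
        have hS' : ∀ᶠ x in germ z, x ∈ S := hS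
        by_contra! hno
        have hall : ∀ᶠ x in germ z, ∀ i, x ∈ (A i)ᶜ :=
          eventually_all.2 fun i => ((hA i).mem_germ_or_compl z).resolve_left (hno i)
        obtain ⟨x, hx, hxS, hxA⟩ := ((hz z).and (hS'.and hall)).exists
        obtain ⟨i, hi⟩ := hx.2.1 hxS
        exact hxA i hi
      · rintro ⟨i, hi⟩
        have hi' : ∀ᶠ x in germ z, x ∈ A i := hi
        exact ((hz z).and hi').mono fun x hx => hx.1.2.2 ⟨i, hx.2⟩
  · rintro ⟨hd, hu⟩
    filter_upwards [hS.eventually_mem_germ_iff,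
      eventually_all.2 fun i => (hA i).eventually_mem_germ_iff] with x hx hxA
    constructor
    · intro i j hi hj
      by_contra hij
      exact disjoint_left.1 (hd i j hij) ((hxA i (stdResolution F)).2 hi)
        ((hxA j (stdResolution F)).2 hj)
    · rw [← hx (stdResolution F)]
      change (x, stdResolution F) ∈ germSet S ↔ _
      rw [hu, mem_iUnion]
      exact exists_congr fun i => hxA i (stdResolution F)

theorem isRefinedPartition_iff (hF : ∀ x ∈ F, √(1 + x ^ 2) ∈ F) {P : Set (Space F 2)}
    (hP : IsPolygon P) {m : ℕ} {A : Fin m → Set (Space F 2)} :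
    IsRefinedPartition A (refinement P) ↔
      (∀ i, IsPolygon (A i) ∧ (A i).Nonempty) ∧ AEPartition P A := by
  refine and_congr_right fun hA => ?_
  rw [aePartition_iff_germSet hP.polyhedral fun i => (hA i).1.polyhedral,
    refinement_eq_germSet hF hP]
  simp only [refinement_eq_germSet hF (hA _).1]

/-- Pieces of a scissors congruence may be empty or fail to be polygons; triangulating them gives
the nonempty polygons that equidecomposability demands. -/
theorem ScissorsCongruent.exists_triangles {S T : Set (Space F 2)} (h : ScissorsCongruent S T) :
    ∃ (m : ℕ) (φ g : Fin m → Space F 2 ≃ᵃ[F] Space F 2),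
      (∀ i, IsTranslationOrReflection (g i)) ∧ AEPartition S (fun i => φ i '' stdTriangle F) ∧
      AEPartition T fun i => g i '' (φ i '' stdTriangle F) := by
  obtain ⟨ι, _, A, g, hA, hg, hS, hT⟩ := h
  choose κ _ φ hφ using fun i => (hA i).1.exists_aePartition_triangle (hA i).2
  let e := (Fintype.equivFin (Σ i, κ i)).symm
  refine ⟨_, fun k => φ (e k).1 (e k).2, fun k => g (e k).1, fun k => hg _,
    (hS.sigma hφ).reindex e, ?_⟩
  exact (hT.sigma fun i => (hφ i).image (g i)).reindex e

end RefinedGeometry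

end

theorem mainTheorem4 (F : Subfield ℝ) (hF : ∀ x ∈ F, √(1 + x ^ 2) ∈ F)
    (P Q : Set (RefinedGeometry.Space F 2))
    (hP : RefinedGeometry.IsPolygon P) (hQ : RefinedGeometry.IsPolygon Q) :
    RefinedGeometry.area P = RefinedGeometry.area Q ↔
      RefinedGeometry.Equidecomposable
        (RefinedGeometry.refinement P) (RefinedGeometry.refinement Q) := by
  open RefinedGeometry in
  constructor
  · intro h
    obtain ⟨m, φ, g, hg, h1, h2⟩ := (scissorsCongruent_of_area_eq hP.polyhedral hP.coordBounded
      hQ.polyhedral hQ.coordBounded h).exists_triangles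
    refine ⟨m, fun i => φ i '' stdTriangle F, fun i => g i '' (φ i '' stdTriangle F),
      (isRefinedPartition_iff hF hP).2 ⟨fun i => ?_, h1⟩,
      (isRefinedPartition_iff hF hQ).2 ⟨fun i => ?_, h2⟩, fun i => (hg i).congruent _⟩
    · exact ⟨isPolygon_image_stdTriangle _, image_stdTriangle_nonempty _⟩
    · have : g i '' (φ i '' stdTriangle F) = ((φ i).trans (g i)) '' stdTriangle F := by
        rw [Set.image_image]
        rfl
      rw [this]
      exact ⟨isPolygon_image_stdTriangle _, image_stdTriangle_nonempty _⟩
  · rintro ⟨m, A, B, hA, hB, h⟩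
    obtain ⟨hA, hPA⟩ := (isRefinedPartition_iff hF hP).1 hA
    obtain ⟨hB, hQB⟩ := (isRefinedPartition_iff hF hQ).1 hB
    rw [hPA.area_eq fun i => (hA i).1.polyhedral, hQB.area_eq fun i => (hB i).1.polyhedral]
    exact Finset.sum_congr rfl fun i _ => (h i).area_eq
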